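/- Let $\Gamma$ be a countably infinite discrete group. A $\Gamma$-space is a topological space with a continuous action of $\Gamma$. The action is free if all point stabilizers are trivial, and the free part $\mathsf{Free}(X)$ of a $\Gamma$-space $X$ is the set of points with trivial stabilizer, with the subspace topology. For a finite $F\subset\Gamma$, a set $U\subseteq X$ is $F$-syndetic if for every $x\in X$ there is $\sigma\in F$ with $\sigma\cdot x\in U$. A $\Gamma$-space $X$ is amply syndetic if it is Polish and for every finite tuple $U_1,\dots,U_k$ of nonempty open subsets of $X$ there is $n\in\mathbb N$ such that for every finite $F\subset\Gamma$ with $|F|\ge n$ there is a continuous $\Gamma$-equivariant map $\pi\colon X\to X$ for which all of $\pi^{-1}(U_1),\dots,\pi^{-1}(U_k)$ are $F$-syndetic. For $k\ge1$ let $\Gamma$ act on $\{0,\dots,k-1\}^\Gamma$ (product topology) by $(\gamma\cdot x)(\delta)=x(\delta\gamma)$. For a finite $\Phi\subset\Gamma$ let $\mathsf{Cay}(\Gamma,\Phi)$ be the graph on $\Gamma$ with edges $\{\gamma,\sigma\gamma\}$, where $\gamma\in\Gamma$, $\sigma\in\Phi$ and $\sigma\gamma\ne\gamma$. For $s\ge1$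 let $\mathsf{Sep}(s,\Phi)$ be the shift-invariant set, with the subspace topology, of all $x\colon\Gamma\to\{0,\dots,s\}$ such that for each $0\le i\le s$ every connected component of the subgraph of $\mathsf{Cay}(\Gamma,\Phi)$ induced by $x^{-1}(i)$ is finite. Given an enumeration $(\Phi_n)_{n\in\mathbb N}$ of the finite subsets of $\Gamma$ in which every finite subset appears infinitely often, let $\mathsf{Sep}(s)=\prod_{n\in\mathbb N}\mathsf{Sep}(s,\Phi_n)$, with the product topology and the diagonal action. Theorem. (1) For every such enumeration and every integer $s\ge1$, $\mathsf{Free}(\mathsf{Sep}(s))$ is an amply syndetic $\Gamma$-space; moreover it is nonempty, free and zero-dimensional (its clopen subsets form a basis). (2) Consequently, there exists a nonempty, free, zero-dimensional amply syndetic $\Gamma$-space. -/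

import Mathlib

universe u

/-- A set `U` of vertices is `G`-finite if every connected component of the induced subgraph
`G[U]` is finite. -/
def GraphFinite {V : Type*} (G : SimpleGraph V) (U : Set V) : Prop :=
  ∀ C : (G.induce U).ConnectedComponent, C.supp.Finite

/-- The Schreier graph of an action of `Γ` on `X`: the edges are the pairs `{x, σ • x}` with
`σ ∈ Φ` and `σ • x ≠ x`. -/
def schreierGraph {Γ : Type*} (X : Type*) [Group Γ] [MulAction Γ X] (Φ : Set Γ) :
    SimpleGraph X where
  Adj x y := x ≠ y ∧ ((∃ σ ∈ Φ, σ • x = y) ∨ (∃ σ ∈ Φ, σ • y = x))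
  symm := ⟨fun _ _ h => ⟨h.1.symm, h.2.symm⟩⟩
  loopless := ⟨fun _ h => h.1 rfl⟩

/-- The Cayley graph: the Schreier graph of the left multiplication action of `Γ` on itself. -/
def cayleyGraph {Γ : Type*} [Group Γ] (Φ : Set Γ) : SimpleGraph Γ :=
  schreierGraph Γ Φ

/-- The space `k ^ Γ` of maps from `Γ` to the discrete `k`-element set, with the product
topology. -/
def BernoulliShift (k : ℕ) (Γ : Type*) : Type _ := Γ → Fin k

instance (k : ℕ) (Γ : Type*) : TopologicalSpace (BernoulliShift k Γ) :=
  inferInstanceAs (TopologicalSpace (Γ → Fin k))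

/-- The shift action `(γ • x) δ = x (δ γ)`. -/
instance (k : ℕ) (Γ : Type*) [Group Γ] : MulAction Γ (BernoulliShift k Γ) where
  smul γ x := fun δ => x (δ * γ)
  one_smul x := funext fun δ => congrArg x (mul_one δ)
  mul_smul γ γ' x := funext fun δ => congrArg x (mul_assoc δ γ γ').symm

/-- An `(s, Φ)`-separator is a map `x : Γ → {0, …, s}` all of whose colour classes are finite
with respect to the Cayley graph of `Φ`. -/
def IsSeparator {Γ : Type*} [Group Γ] (s : ℕ) (Φ : Finset Γ)
    (x : BernoulliShift (s + 1) Γ) : Prop :=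
  ∀ i : Fin (s + 1), GraphFinite (cayleyGraph (Φ : Set Γ)) {γ : Γ | x γ = i}

theorem IsSeparator.smul {Γ : Type*} [Group Γ] {s : ℕ} {Φ : Finset Γ}
    {x : BernoulliShift (s + 1) Γ} (hx : IsSeparator s Φ x) (γ : Γ) :
    IsSeparator s Φ (γ • x) := by
  intro i C
  let f : (cayleyGraph (Φ : Set Γ)).induce {δ : Γ | (γ • x) δ = i} →g
      (cayleyGraph (Φ : Set Γ)).induce {δ : Γ | x δ = i} :=
    { toFun := fun δ => ⟨δ.1 * γ, δ.2⟩
      map_rel' := by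
        rintro ⟨a, ha⟩ ⟨b, hb⟩ h
        simpa [cayleyGraph, schreierGraph, ← mul_assoc] using h }
  have hf : Function.Injective f := fun a b h =>
    Subtype.ext (mul_right_cancel (congrArg Subtype.val h))
  refine Set.Finite.of_finite_image ((hx i (C.map f)).subset ?_) hf.injOn
  rintro _ ⟨δ, hδ, rfl⟩
  rw [SimpleGraph.ConnectedComponent.mem_supp_iff] at hδ ⊢
  rw [← hδ]
  rfl

/-- The space `Sep(s, Φ)` of `(s, Φ)`-separators: a shift-invariant subset of `(s + 1) ^ Γ`, with
the subspace topology and the shift action. -/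
def SepFinset {Γ : Type*} [Group Γ] (s : ℕ) (Φ : Finset Γ) :
    SubMulAction Γ (BernoulliShift (s + 1) Γ) where
  carrier := {x | IsSeparator s Φ x}
  smul_mem' γ _ hx := IsSeparator.smul hx γ

/-- The space `Sep(s) = ∏ n, Sep(s, Φ n)` of asymptotic `s`-separators, with the product topology
and the diagonal action. -/
abbrev AsymptoticSep {Γ : Type*} [Group Γ] (Φ : ℕ → Finset Γ) (s : ℕ) : Type _ :=
  ∀ n : ℕ, SepFinset s (Φ n)

/-- `Φ` enumerates the finite subsets of `Γ`, each of them infinitely often. -/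
def EnumeratesInfinitelyOften {Γ : Type*} (Φ : ℕ → Finset Γ) : Prop :=
  ∀ A : Finset Γ, {n : ℕ | Φ n = A}.Infinite

/-- The free part of an action: the invariant set of points with trivial stabilizer. -/
def freePart (Γ X : Type*) [Group Γ] [MulAction Γ X] : SubMulAction Γ X where
  carrier := {x | MulAction.stabilizer Γ x = ⊥}
  smul_mem' γ x hx := by
    have hx' : MulAction.stabilizer Γ x = ⊥ := hx
    change MulAction.stabilizer Γ (γ • x) = ⊥
    rw [MulAction.stabilizer_smul_eq_stabilizer_map_conj, hx', Subgroup.map_bot]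

/-- An action is free if all stabilizers are trivial. -/
def IsFreeAction (Γ X : Type*) [Group Γ] [MulAction Γ X] : Prop :=
  ∀ x : X, MulAction.stabilizer Γ x = ⊥

/-- A space is zero-dimensional if its clopen sets form a basis. -/
def IsZeroDimensional (X : Type*) [TopologicalSpace X] : Prop :=
  TopologicalSpace.IsTopologicalBasis {U : Set X | IsClopen U}

/-- `U` is `F`-syndetic if `F⁻¹ • U = X`, that is, if every `x` satisfies `σ • x ∈ U` for some
`σ ∈ F`. -/
def IsFSyndetic {Γ X : Type*} [Group Γ] [MulAction Γ X] (F : Finset Γ) (U : Set X) : Prop :=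
  ∀ x : X, ∃ σ ∈ F, σ • x ∈ U

/-- Amply syndetic `Γ`-spaces, for a discrete group `Γ`. As `Γ` is discrete, continuity of the
action means that every element of `Γ` acts continuously. -/
structure IsAmplySyndetic (Γ X : Type*) [Group Γ] [TopologicalSpace X] [MulAction Γ X] :
    Prop where
  polish : PolishSpace X
  continuous_action : ContinuousConstSMul Γ X
  ample : ∀ (k : ℕ) (U : Fin k → Set X), (∀ i, IsOpen (U i)) → (∀ i, (U i).Nonempty) →
    ∃ n : ℕ, ∀ F : Finset Γ, n ≤ F.card →
      ∃ π : X → X, Continuous π ∧ (∀ (γ : Γ) (x : X), π (γ • x) = γ • π x) ∧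
        ∀ i, IsFSyndetic F (π ⁻¹' U i)

/-! The difficulty is to realise prescribed finite patterns along `F`-syndetic sets by a continuous
equivariant map, with `F` subject only to a lower bound on its size. Fix a point of each given open
set and a finite set of coordinates that forces membership. One wants sparse marks of `k` kinds in
every orbit, each kind met from every point by some element of `F`; near a mark of kind `i`, the map
copies the pattern of the `i`-th point.

The marks come from a continuous local lemma. A large `F` contains `m` elements whose `E`-translates
are disjoint, and a random labelling misses some kind in all `m` blocks with probability at most `k
(1 - 1/c) ^ m`. A separator at the scale of the window splits the space into `s + 1` levels with
finite components, and a window meets each level in at most one component. Each level is therefore a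
family of finite problems, solved by the finite local lemma at a loss polynomial in `m`. As `s` is
fixed, `s + 1` such losses do not beat exponential decay. Choices are continuous because finite
components have locally constant equivariant roots (`exists_root`).

Two features of `Sep(s)` finish the argument. Separators at every scale are coordinates of the point
itself, and rewriting a coarse separator on sparse translates leaves a separator at the finer scale
(`IsSeparator.of_eq_off_translates`). Since each scale recurs infinitely often, the finitely many
coordinates to be rewritten can be vacated while all the old data are stored in the others, so the
image stays in the free part (`exists_continuous_equivariant`). -/

open Topology

/-! ### The Lovász local lemma in a finite product -/

section LocalLemma

open Finset

/-- Events that depend on disjoint sets of coordinates are independent. -/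
theorem card_inter_mul_card_of_disjoint_dependence {V K : Type*} [Fintype V] [DecidableEq V]
    [Fintype K] [DecidableEq K] (A N : Finset (V → K)) (D : Finset V)
    (hA : ∀ f g : V → K, (∀ v ∈ D, f v = g v) → f ∈ A → g ∈ A)
    (hN : ∀ f g : V → K, (∀ v ∉ D, f v = g v) → f ∈ N → g ∈ N) :
    #(A ∩ N) * Fintype.card (V → K) = #A * #N := by
  rw [← Finset.card_univ, ← Finset.card_product, ← Finset.card_product]
  -- The involution that exchanges the values of the two functions off `D`.
  refine Finset.card_bij' (fun p _ => (D.piecewise p.1 p.2, D.piecewise p.2 p.1))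
    (fun p _ => (D.piecewise p.1 p.2, D.piecewise p.2 p.1)) ?_ ?_ ?_ ?_
  · rintro ⟨f, g⟩ h
    simp only [mem_product, mem_inter, mem_univ, and_true] at h ⊢
    exact ⟨hA f _ (fun v hv => by simp [hv]) h.1, hN f _ (fun v hv => by simp [hv]) h.2⟩
  · rintro ⟨f, g⟩ h
    simp only [mem_product, mem_inter, mem_univ, and_true] at h ⊢
    exact ⟨hA f _ (fun v hv => by simp [hv]) h.1, hN g _ (fun v hv => by simp [hv]) h.2⟩
  · rintro ⟨f, g⟩ h
    ext v <;> by_cases hv : v ∈ D <;> simp [hv]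
  · rintro ⟨f, g⟩ h
    ext v <;> by_cases hv : v ∈ D <;> simp [hv]

/-- The symmetric Lovász local lemma for events `A i` in a finite product space, each of
probability at most `1 / (4 * Δ)`. -/
theorem exists_forall_notMem_of_local {V K I : Type*} [Fintype V] [DecidableEq V] [Fintype K]
    [Nonempty K] [DecidableEq K] [DecidableEq I] (A : I → Finset (V → K)) (vbl : I → Finset V)
    (dep : ∀ i, ∀ f g : V → K, (∀ v ∈ vbl i, f v = g v) → f ∈ A i → g ∈ A i)
    (Δ : ℕ) (hΔ0 : 0 < Δ) (s : Finset I)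
    (hΔ : ∀ i ∈ s, #{j ∈ s | ¬ Disjoint (vbl i) (vbl j)} ≤ Δ)
    (hp : ∀ i ∈ s, #(A i) * (4 * Δ) ≤ Fintype.card (V → K)) :
    ∃ f : V → K, ∀ i ∈ s, f ∉ A i := by
  set N : Finset I → Finset (V → K) := fun S => {f | ∀ j ∈ S, f ∉ A j} with hN
  -- The conditional bound: given that the events of `S` fail, `A i` has probability at most `1 / (2
  -- * Δ)`.
  have key : ∀ S : Finset I, S ⊆ s → 0 < #(N S) ∧
      ∀ i ∈ s, #(A i ∩ N S) * (2 * Δ) ≤ #(N S) := by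
    intro S
    induction S using Finset.strongInduction with
    | H S ih =>
    intro hS
    have hpos : 0 < #(N S) := by
      rcases S.eq_empty_or_nonempty with rfl | ⟨j, hj⟩
      · have : N ∅ = Finset.univ := by ext; simp [hN]
        rw [this, Finset.card_univ]; exact Fintype.card_pos
      · obtain ⟨h0, h1⟩ := ih (S.erase j) (erase_ssubset hj) ((erase_subset _ _).trans hS)
        have h2 := h1 j (hS hj)
        have h3 : N (S.erase j) ⊆ (A j ∩ N (S.erase j)) ∪ N S := by
          intro f hf
          by_cases hfj : f ∈ A j
          · exact mem_union_left _ (mem_inter.2 ⟨hfj, hf⟩)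
          · refine mem_union_right _ ?_
            simp only [hN, mem_filter, mem_univ, true_and, mem_erase] at hf ⊢
            intro l hl
            by_cases hlj : l = j
            · exact hlj ▸ hfj
            · exact hf l ⟨hlj, hl⟩
        have h4 := (card_le_card h3).trans (card_union_le _ _)
        nlinarith
    refine ⟨hpos, fun i hi => ?_⟩
    set S1 := {j ∈ S | ¬ Disjoint (vbl i) (vbl j)} with hS1
    set S2 := {j ∈ S | Disjoint (vbl i) (vbl j)} with hS2
    have hmono : N S ⊆ N S2 := by
      intro f hf
      simp only [hN, mem_filter, mem_univ, true_and] at hf ⊢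
      exact fun j hj => hf j (mem_filter.1 hj).1
    have hind : #(A i ∩ N S2) * Fintype.card (V → K) = #(A i) * #(N S2) := by
      refine card_inter_mul_card_of_disjoint_dependence _ _ (vbl i) (dep i) ?_
      intro f g hfg hf
      simp only [hN, mem_filter, mem_univ, true_and] at hf ⊢
      intro j hj hg
      refine hf j hj (dep j g f (fun v hv => (hfg v fun hvi => ?_).symm) hg)
      exact Finset.disjoint_left.1 (mem_filter.1 hj).2 hvi hv
    have hpi := hp i hi
    have hcard : 0 < Fintype.card (V → K) := Fintype.card_pos
    have hA2 : #(A i ∩ N S2) * (4 * Δ) ≤ #(N S2) := by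
      refine Nat.le_of_mul_le_mul_right ?_ hcard
      calc #(A i ∩ N S2) * (4 * Δ) * Fintype.card (V → K)
          = (#(A i) * (4 * Δ)) * #(N S2) := by rw [mul_right_comm, hind]; ring
        _ ≤ Fintype.card (V → K) * #(N S2) := Nat.mul_le_mul_right _ hpi
        _ = _ := mul_comm _ _
    -- Passing from `S2` to `S` adds at most `Δ` neighbours of `i`, each of conditional probability
    -- at most `1 / (2 * Δ)`, so half of `N S2` survives. This turns the `4` of `hA2` into the `2`
    -- of the claim.
    have hhalf : #(N S2) ≤ 2 * #(N S) := by
      by_cases hS12 : S2 = S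
      · rw [hS12]; omega
      · have hss : S2 ⊂ S := (filter_subset _ _).ssubset_of_ne hS12
        obtain ⟨-, h1⟩ := ih S2 hss (hss.1.trans hS)
        have h3 : N S2 ⊆ N S ∪ S1.biUnion (fun j => A j ∩ N S2) := by
          intro f hf
          by_cases hfS : f ∈ N S
          · exact mem_union_left _ hfS
          · refine mem_union_right _ ?_
            have hf' := hf
            simp only [hN, mem_filter, mem_univ, true_and] at hfS hf'
            push Not at hfS
            obtain ⟨j, hj, hfj⟩ := hfS
            refine mem_biUnion.2 ⟨j, mem_filter.2 ⟨hj, fun hd => ?_⟩, mem_inter.2 ⟨hfj, hf⟩⟩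
            exact hf' j (mem_filter.2 ⟨hj, hd⟩) hfj
        have h4 := (card_le_card h3).trans (card_union_le _ _)
        have h5 : #(S1.biUnion (fun j => A j ∩ N S2)) ≤ ∑ j ∈ S1, #(A j ∩ N S2) :=
          card_biUnion_le
        have h6 : (∑ j ∈ S1, #(A j ∩ N S2)) * (2 * Δ) ≤ Δ * #(N S2) := by
          rw [Finset.sum_mul]
          calc ∑ j ∈ S1, #(A j ∩ N S2) * (2 * Δ) ≤ ∑ j ∈ S1, #(N S2) :=
                sum_le_sum fun j hj => h1 j (hS (mem_filter.1 hj).1)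
            _ = #S1 * #(N S2) := by simp
            _ ≤ Δ * #(N S2) := Nat.mul_le_mul_right _
                ((card_le_card (filter_subset_filter _ hS)).trans (hΔ i hi))
        have h7 : (∑ j ∈ S1, #(A j ∩ N S2)) * 2 ≤ #(N S2) := by
          refine Nat.le_of_mul_le_mul_left ?_ hΔ0
          linarith
        omega
    have hle : #(A i ∩ N S) ≤ #(A i ∩ N S2) := card_le_card (inter_subset_inter_left hmono)
    nlinarith
  obtain ⟨f, hf⟩ := Finset.card_pos.1 (key s subset_rfl).1
  exact ⟨f, by simpa [hN] using hf⟩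

/-! ### Conditional probabilities and the choice of values on a finite set -/

open Classical in
/-- The number of functions that belong to `B` after their values on `S` have been replaced by
those of `a`: up to normalisation, the conditional probability of `B` given `a` on `S`. -/
noncomputable def condCount {ι K : Type*} [Fintype ι] [Fintype K] (B : Finset (ι → K))
    (S : Set ι) (a : ι → K) : ℕ :=
  #{g : ι → K | S.piecewise a g ∈ B}

theorem condCount_empty {ι K : Type*} [Fintype ι] [Fintype K] (B : Finset (ι → K))
    (a : ι → K) : condCount B ∅ a = #B := by
  classical
  simp [condCount]

theorem condCount_congr {ι K : Type*} [Fintype ι] [Fintype K] (B : Finset (ι → K))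
    {S T : Set ι} {a b : ι → K} (hST : S = T) (hab : ∀ t ∈ S, a t = b t) :
    condCount B S a = condCount B T b := by
  classical
  subst hST
  have h : ∀ g : ι → K, S.piecewise a g = S.piecewise b g := fun g => by
    ext t
    by_cases ht : t ∈ S <;> simp [ht, hab]
  simp [condCount, h]

theorem condCount_univ {ι K : Type*} [Fintype ι] [DecidableEq ι] [Fintype K] {B : Finset (ι → K)}
    {a : ι → K} (ha : a ∈ B) : condCount B Set.univ a = Fintype.card (ι → K) := by
  classical
  simp only [condCount, Set.piecewise_univ, ha, filter_true, card_univ]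
  congr!

open Classical in
/-- Averaging the conditional probability over all values on `C` gives it back. -/
theorem sum_condCount {ι K V : Type*} [Fintype ι] [Fintype K] (B : Finset (ι → K)) (e : ι → V)
    (he : Function.Injective e) (C : Finset V) (S : Set V) (hSC : ∀ v ∈ C, v ∉ S)
    (a : V → K) :
    ∑ h : C → K, condCount B (e ⁻¹' (S ∪ C))
      (fun t => if ht : e t ∈ C then h ⟨e t, ht⟩ else a (e t)) =
      Fintype.card (C → K) * condCount B (e ⁻¹' S) (a ∘ e) := by
  simp only [condCount]
  rw [← Finset.card_univ, ← Finset.card_sigma, ← Finset.card_product]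
  -- `φ` exchanges the values of `h` and `g` at the window positions that `e` sends into `C`.
  set φ : (Σ _ : C → K, ι → K) → (C → K) × (ι → K) := fun p =>
    (fun v => if hv : ∃ t, e t = v then p.2 hv.choose else p.1 v,
      fun t => if ht : e t ∈ C then p.1 ⟨e t, ht⟩ else p.2 t) with hφ
  have hch : ∀ t (hv : ∃ t', e t' = e t), hv.choose = t := fun t hv => he hv.choose_spec
  have hinv : ∀ p : Σ _ : C → K, ι → K,
      φ ⟨(φ p).1, (φ p).2⟩ = (p.1, p.2) := by
    rintro ⟨h, g⟩
    ext v
    · by_cases hv : ∃ t, e t = v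
      · obtain ⟨t, ht⟩ := hv
        obtain ⟨v, hvC⟩ := v
        simp only at ht
        subst ht
        simp [hφ, hch, hvC]
      · simp [hφ, hv]
    · by_cases ht : e v ∈ C
      · simp [hφ, ht, hch]
      · simp [hφ, ht]
  refine Finset.card_bij' (fun p _ => φ p)
    (fun q _ => ⟨(φ ⟨q.1, q.2⟩).1, (φ ⟨q.1, q.2⟩).2⟩) ?_ ?_ ?_ ?_
  · rintro ⟨h, g⟩ hp
    simp only [mem_sigma, mem_filter, mem_univ, true_and, mem_product] at hp ⊢
    convert hp using 1
    ext t
    by_cases ht : e t ∈ C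
    · have := hSC _ ht
      simp [hφ, ht, Set.piecewise, this]
    · by_cases ht' : e t ∈ S <;> simp [hφ, ht, Set.piecewise, ht']
  · rintro ⟨h, g⟩ hp
    simp only [mem_sigma, mem_filter, mem_univ, true_and, mem_product] at hp ⊢
    convert hp using 1
    ext t
    by_cases ht : e t ∈ C
    · have := hSC _ ht
      simp [hφ, ht, Set.piecewise, this, hch]
    · by_cases ht' : e t ∈ S <;> simp [hφ, ht, Set.piecewise, ht']
  · rintro ⟨h, g⟩ hp
    have := hinv ⟨h, g⟩
    simp only [Prod.ext_iff] at this
    simp only [Sigma.mk.injEq, heq_eq_eq]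
    exact this
  · rintro ⟨h, g⟩ hp
    exact hinv ⟨h, g⟩

open Classical in
/-- One stage of the local lemma: values on the finite set `C` can be chosen so that the
conditional probabilities of all events grow at most by a factor linear in the dependency
degree. -/
theorem exists_condCount_le {ι K V I : Type*} [Fintype ι] [Nonempty ι] [Fintype K] [Nonempty K]
    (B : Finset (ι → K)) (e : I → ι → V) (he : ∀ i, Function.Injective (e i))
    (he' : ∀ t, Function.Injective fun i => e i t) (C : Finset V) (S : Set V)
    (hSC : ∀ v ∈ C, v ∉ S) (a : V → K) (b : ℕ) (s : Finset I)
    (hb : ∀ i ∈ s, condCount B (e i ⁻¹' S) (a ∘ e i) ≤ b) :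
    ∃ h : V → K, ∀ i ∈ s, condCount B (e i ⁻¹' (S ∪ C))
      (fun t => if e i t ∈ C then h (e i t) else a (e i t)) ≤
        4 * Fintype.card ι ^ 2 * b := by
  set Δ := Fintype.card ι ^ 2 with hΔ
  have hΔ0 : 0 < Δ := pow_pos Fintype.card_pos 2
  let cc : I → (C → K) → ℕ := fun i h => condCount B (e i ⁻¹' (S ∪ C))
      (fun t => if ht : e i t ∈ C then h ⟨e i t, ht⟩ else a (e i t))
  -- The event for `i` is that its conditional count exceeds `4 * Δ` times the old bound. Markov's
  -- inequality and the averaging identity bound its probability by `1 / (4 * Δ)`.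
  obtain ⟨h, hh⟩ := exists_forall_notMem_of_local
    (A := fun i => {h : C → K | 4 * Δ * b < cc i h})
    (vbl := fun i => {v : C | ∃ t, e i t = v}) (by
      intro i f g hfg hf
      simp only [mem_filter, mem_univ, true_and] at hf hfg ⊢
      refine hf.trans_eq (condCount_congr B rfl fun t _ => ?_)
      by_cases ht : e i t ∈ C
      · simp [ht, hfg ⟨e i t, ht⟩ ⟨t, rfl⟩]
      · simp [ht]) Δ hΔ0 s (by
      intro i hi
      -- Windows `i` and `j` meet only if `e j t' = e i t` for some pair `(t, t')`, and by `he'`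
      -- each pair determines `j`. Hence the degree is at most `Fintype.card ι ^ 2`.
      have hsub : {j ∈ s | ¬ Disjoint ({v : C | ∃ t, e i t = v} : Finset C)
          ({v : C | ∃ t, e j t = v} : Finset C)} ⊆ (Finset.univ : Finset (ι × ι)).biUnion
            (fun p => {j ∈ s | e j p.2 = e i p.1}) := by
        intro j hj
        obtain ⟨hjs, hd⟩ := mem_filter.1 hj
        obtain ⟨v, hv1, hv2⟩ := Finset.not_disjoint_iff.1 hd
        simp only [mem_filter, mem_univ, true_and] at hv1 hv2
        obtain ⟨t, ht⟩ := hv1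
        obtain ⟨t', ht'⟩ := hv2
        exact mem_biUnion.2 ⟨(t, t'), mem_univ _, mem_filter.2 ⟨hjs, by rw [ht, ht']⟩⟩
      refine (card_le_card hsub).trans (card_biUnion_le.trans ?_)
      calc ∑ p : ι × ι, #{j ∈ s | e j p.2 = e i p.1} ≤ ∑ p : ι × ι, 1 := by
            refine sum_le_sum fun p _ => card_le_one.2 fun j hj l hl => he' p.2 ?_
            exact (mem_filter.1 hj).2.trans (mem_filter.1 hl).2.symm
        _ = Δ := by simp [hΔ, sq]) (by
      intro i hi
      have hsum : ∑ h : C → K, cc i h = Fintype.card (C → K) * condCount B (e i ⁻¹' S) (a ∘ e i) :=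
        sum_condCount B (e i) (he i) C S hSC a
      have hmarkov : #{h : C → K | 4 * Δ * b < cc i h} * (4 * Δ * b + 1) ≤ ∑ h : C → K, cc i h := by
        rw [← smul_eq_mul]
        refine (Finset.card_nsmul_le_sum _ (cc i) _ fun h hh => (mem_filter.1 hh).2).trans ?_
        exact sum_le_sum_of_subset (filter_subset _ _)
      have hle := hmarkov.trans (hsum.le.trans (Nat.mul_le_mul_left _ (hb i hi)))
      rcases Nat.eq_zero_or_pos b with rfl | hbpos
      · simp only [mul_zero, Nat.le_zero, zero_add, mul_one] at hle ⊢
        rw [hle]; simp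
      · refine Nat.le_of_mul_le_mul_right ?_ hbpos
        nlinarith)
  obtain ⟨k⟩ := ‹Nonempty K›
  refine ⟨fun v => if hv : v ∈ C then h ⟨v, hv⟩ else k, fun i hi => ?_⟩
  have := hh i hi
  simp only [mem_filter, mem_univ, true_and, not_lt] at this
  refine le_trans (le_of_eq (condCount_congr B rfl fun t _ => ?_)) this
  by_cases ht : e i t ∈ C <;> simp [ht]

/-! ### Finite components of level sets and their roots -/

/-- The component of `x` in its level set of `w` with respect to the Schreier graph of `Ψ`,
as a set of group elements. -/
def orbitComponent {Γ X : Type*} [Group Γ] [MulAction Γ X] (Ψ : Finset Γ) (w : X → ℕ) (x : X) :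
    Set Γ :=
  {γ | Relation.ReflTransGen (fun γ δ => δ * γ⁻¹ ∈ Ψ ∧ w (δ • x) = w x) 1 γ}

section OrbitComponent

variable {Γ X : Type*} [Group Γ] [MulAction Γ X] {Ψ : Finset Γ} {w : X → ℕ} {x : X} {γ δ : Γ}

theorem one_mem_orbitComponent : (1 : Γ) ∈ orbitComponent Ψ w x :=
  Relation.ReflTransGen.refl

theorem orbitComponent_step (hγ : γ ∈ orbitComponent Ψ w x) (hδ : δ * γ⁻¹ ∈ Ψ)
    (hw : w (δ • x) = w x) : δ ∈ orbitComponent Ψ w x :=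
  Relation.ReflTransGen.tail hγ ⟨hδ, hw⟩

theorem eq_of_mem_orbitComponent (hγ : γ ∈ orbitComponent Ψ w x) : w (γ • x) = w x := by
  rcases Relation.ReflTransGen.cases_tail hγ with h | ⟨_, _, h⟩
  · simp [h]
  · exact h.2

theorem mul_mem_orbitComponent (hγ : γ ∈ orbitComponent Ψ w x)
    (hδ : δ ∈ orbitComponent Ψ w (γ • x)) : δ * γ ∈ orbitComponent Ψ w x := by
  have hw := eq_of_mem_orbitComponent hγ
  induction hδ with
  | refl => simpa using hγ
  | tail _ h ih =>
    refine orbitComponent_step ih ?_ (by rw [mul_smul, h.2, hw])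
    simpa [mul_assoc] using h.1

/-- Symmetry of `Ψ` lets paths be reversed; thus all points of a component see the same set,
recentred. -/
theorem inv_mem_orbitComponent (hΨ : ∀ σ ∈ Ψ, σ⁻¹ ∈ Ψ) (hγ : γ ∈ orbitComponent Ψ w x) :
    γ⁻¹ ∈ orbitComponent Ψ w (γ • x) := by
  induction hγ with
  | refl => simpa using one_mem_orbitComponent
  | @tail γ δ hγ h ih =>
    have hw := eq_of_mem_orbitComponent hγ
    have h1 : γ * δ⁻¹ ∈ orbitComponent Ψ w (δ • x) :=
      orbitComponent_step one_mem_orbitComponent (by simpa using hΨ _ h.1)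
        (by simp [smul_smul, hw, h.2])
    have := mul_mem_orbitComponent h1 (δ := γ⁻¹) (by simpa [smul_smul] using ih)
    simpa using this

theorem mem_orbitComponent_smul_iff (hΨ : ∀ σ ∈ Ψ, σ⁻¹ ∈ Ψ) (hγ : γ ∈ orbitComponent Ψ w x) :
    δ ∈ orbitComponent Ψ w (γ • x) ↔ δ * γ ∈ orbitComponent Ψ w x := by
  refine ⟨mul_mem_orbitComponent hγ, fun h => ?_⟩
  have := mul_mem_orbitComponent (inv_mem_orbitComponent hΨ hγ) (δ := δ * γ) (by simpa using h)
  simpa using this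

/-- A finite component is determined by the values of `w` on it and on its `Ψ`-neighbours: finitely
many locally constant conditions. -/
theorem eventually_orbitComponent_eq [TopologicalSpace X] [ContinuousConstSMul Γ X]
    (hw : IsLocallyConstant w) (hfin : (orbitComponent Ψ w x).Finite) :
    ∀ᶠ x' in 𝓝 x, orbitComponent Ψ w x' = orbitComponent Ψ w x := by
  have hw' : ∀ δ : Γ, ∀ᶠ x' in 𝓝 x, w (δ • x') = w (δ • x) := fun δ =>
    (continuous_const_smul δ).continuousAt.eventually
      ((IsLocallyConstant.iff_eventually_eq w).1 hw (δ • x))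
  have h1 : ∀ᶠ x' in 𝓝 x, ∀ γ ∈ orbitComponent Ψ w x, w (γ • x') = w (γ • x) :=
    (Filter.eventually_all_finite hfin).2 fun γ _ => hw' γ
  have h2 : ∀ᶠ x' in 𝓝 x, ∀ γ ∈ orbitComponent Ψ w x, ∀ σ ∈ Ψ,
      w ((σ * γ) • x') = w ((σ * γ) • x) :=
    (Filter.eventually_all_finite hfin).2 fun γ _ =>
      (Filter.eventually_all_finset Ψ).2 fun σ _ => hw' (σ * γ)
  filter_upwards [h1, h2, (IsLocallyConstant.iff_eventually_eq w).1 hw x] with x' h1 h2 h0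
  ext γ
  constructor
  · intro h
    induction h with
    | refl => exact one_mem_orbitComponent
    | @tail γ δ _ h ih =>
      refine orbitComponent_step ih h.1 ?_
      have := h2 γ ih _ h.1
      rw [inv_mul_cancel_right] at this
      rw [← this, h.2, h0]
  · intro h
    induction h with
    | refl => exact one_mem_orbitComponent
    | @tail γ δ hγ h ih =>
      refine orbitComponent_step ih h.1 ?_
      rw [h1 δ (Relation.ReflTransGen.tail hγ h), h.2, h0]

end OrbitComponent

/-- Finite components have roots, chosen equivariantly and in a locally constant way. -/
theorem exists_root {Γ X : Type*} [Group Γ] [TopologicalSpace X] [MulAction Γ X]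
    [ContinuousConstSMul Γ X] (hfree : IsFreeAction Γ X) (ρ : X → ℝ) (hρ : Continuous ρ)
    (hρ' : Function.Injective ρ) {Ψ : Finset Γ} (hΨ : ∀ σ ∈ Ψ, σ⁻¹ ∈ Ψ) {w : X → ℕ}
    (hw : IsLocallyConstant w) (hfin : ∀ x, (orbitComponent Ψ w x).Finite) :
    ∃ r : X → Γ, IsLocallyConstant r ∧ (∀ x, r x ∈ orbitComponent Ψ w x) ∧
      ∀ x, ∀ γ ∈ orbitComponent Ψ w x, r (γ • x) = r x * γ⁻¹ := by
  -- The root minimises `ρ` on the component. Freeness and injectivity of `ρ` make the minimiser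
  -- unique, hence equivariant; strict inequalities persist nearby, hence it is locally constant.
  have hex : ∀ x, ∃ γ ∈ orbitComponent Ψ w x, ∀ δ ∈ orbitComponent Ψ w x,
      ρ (γ • x) ≤ ρ (δ • x) := fun x =>
    Set.exists_min_image _ (fun γ => ρ (γ • x)) (hfin x) ⟨1, one_mem_orbitComponent⟩
  choose r hr hmin using hex
  have hinj : ∀ x : X, ∀ γ δ : Γ, ρ (γ • x) = ρ (δ • x) → γ = δ := by
    intro x γ δ h
    have h1 : (δ⁻¹ * γ) ∈ MulAction.stabilizer Γ x := by
      rw [MulAction.mem_stabilizer_iff, mul_smul, hρ' h, inv_smul_smul]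
    rw [hfree x, Subgroup.mem_bot] at h1
    exact (inv_mul_eq_one.1 h1).symm
  have huniq : ∀ x, ∀ γ ∈ orbitComponent Ψ w x,
      (∀ δ ∈ orbitComponent Ψ w x, ρ (γ • x) ≤ ρ (δ • x)) → r x = γ := fun x γ hγ h =>
    hinj x _ _ (le_antisymm (hmin x γ hγ) (h _ (hr x)))
  refine ⟨r, ?_, hr, fun x γ hγ => ?_⟩
  · rw [IsLocallyConstant.iff_eventually_eq]
    intro x
    have h1 : ∀ᶠ x' in 𝓝 x, ∀ δ ∈ orbitComponent Ψ w x, ρ (r x • x') ≤ ρ (δ • x') := by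
      refine (Filter.eventually_all_finite (hfin x)).2 fun δ hδ => ?_
      by_cases h : r x = δ
      · subst h; simp
      · have hlt : ρ (r x • x) < ρ (δ • x) :=
          lt_of_le_of_ne (hmin x δ hδ) fun h' => h (hinj x _ _ h')
        have := (((hρ.comp (continuous_const_smul (r x))).tendsto x).eventually_lt
          ((hρ.comp (continuous_const_smul δ)).tendsto x) hlt)
        exact this.mono fun _ h => le_of_lt h
    filter_upwards [h1, eventually_orbitComponent_eq hw (hfin x)] with x' h1 h2
    refine huniq x' _ (h2 ▸ hr x) ?_
    rw [h2]; exact h1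
  · refine huniq _ _ ((mem_orbitComponent_smul_iff hΨ hγ).2 (by simpa using hr x)) ?_
    intro δ hδ
    rw [mem_orbitComponent_smul_iff hΨ hγ] at hδ
    simpa [smul_smul] using hmin x _ hδ

/-! ### The continuous local lemma -/

open Classical in
/-- One stage of the continuous local lemma. -/
theorem exists_isLocallyConstant_condCount_succ {Γ X ι K : Type*} [Group Γ] [TopologicalSpace X]
    [MulAction Γ X] [ContinuousConstSMul Γ X] [Fintype ι] [Nonempty ι] [Fintype K] [Nonempty K]
    (hfree : IsFreeAction Γ X) (ρ : X → ℝ) (hρ : Continuous ρ) (hρ' : Function.Injective ρ)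
    (θ : ι → Γ) (hθ : Function.Injective θ) {Ψ : Finset Γ} (hΨ : ∀ σ ∈ Ψ, σ⁻¹ ∈ Ψ)
    (hθΨ : ∀ t t', θ t * (θ t')⁻¹ ∈ Ψ) {w : X → ℕ} (hw : IsLocallyConstant w)
    (hfin : ∀ x, (orbitComponent Ψ w x).Finite) (B : Finset (ι → K)) (b j : ℕ) (f : X → K)
    (hf : IsLocallyConstant f)
    (hfb : ∀ x, condCount B {t | w (θ t • x) < j} (fun t => f (θ t • x)) ≤ b) :
    ∃ f' : X → K, IsLocallyConstant f' ∧
      ∀ x, condCount B {t | w (θ t • x) < j + 1} (fun t => f' (θ t • x)) ≤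
        4 * Fintype.card ι ^ 2 * b := by
  obtain ⟨r, hrc, hr, hrs⟩ := exists_root hfree ρ hρ hρ' hΨ hw hfin
  -- `Q z h` says that `h` is a good choice of values on the component of `z`. The windows that meet
  -- this component are those based at `((θ t)⁻¹ * c) • z` with `c` in it.
  let Q : X → (Γ → K) → Prop := fun z h => ∀ t : ι, ∀ c ∈ orbitComponent Ψ w z,
    condCount B {t' | w ((θ t' * ((θ t)⁻¹ * c)) • z) < j + 1}
      (fun t' => if θ t' * ((θ t)⁻¹ * c) ∈ orbitComponent Ψ w z then h (θ t' * ((θ t)⁻¹ * c))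
        else f ((θ t' * ((θ t)⁻¹ * c)) • z)) ≤ 4 * Fintype.card ι ^ 2 * b
  have hQ : ∀ z, w z = j → ∃ h, Q z h := by
    intro z hz
    obtain ⟨h, hh⟩ := exists_condCount_le B (fun (γ : Γ) (t : ι) => θ t * γ)
      (fun γ t t' h => hθ (mul_right_cancel h)) (fun t γ γ' h => mul_left_cancel h)
      (hfin z).toFinset {δ | w (δ • z) < j}
      (fun v hv hv' => by
        have := eq_of_mem_orbitComponent ((Set.Finite.mem_toFinset _).1 hv)
        simp only [Set.mem_ofPred_eq] at hv'
        omega) (fun δ => f (δ • z)) b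
      ((Finset.univ : Finset ι).biUnion fun t => (hfin z).toFinset.image fun c => (θ t)⁻¹ * c)
      (fun γ _ => by
        convert hfb (γ • z) using 2
        · ext t; simp [smul_smul]
        · ext t; simp [smul_smul])
    refine ⟨h, fun t c hc => ?_⟩
    have := hh ((θ t)⁻¹ * c) (mem_biUnion.2 ⟨t, mem_univ _, mem_image.2 ⟨c, by simpa using hc, rfl⟩⟩)
    refine le_trans (le_of_eq (condCount_congr B ?_ fun t' _ => ?_)) this
    · ext t'
      simp only [Set.mem_ofPred_eq, Set.Finite.coe_toFinset, Set.mem_preimage, Set.mem_union]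
      constructor
      · intro hlt
        rcases Nat.lt_succ_iff_lt_or_eq.1 hlt with h1 | h1
        · exact Or.inl h1
        · refine Or.inr (orbitComponent_step hc ?_ (h1.trans hz.symm))
          simpa [mul_assoc] using hθΨ t' t
      · rintro (h1 | h1)
        · omega
        · have := eq_of_mem_orbitComponent h1
          omega
    · simp
  -- The selected `h` depends only on the predicate `Q z`, so it is locally constant in `z` because
  -- `Q` is.
  let hsel : X → Γ → K := fun z => Classical.epsilon (Q z)
  have hsel_spec : ∀ z, w z = j → Q z (hsel z) := fun z hz => Classical.epsilon_spec (hQ z hz)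
  have hwev : ∀ (δ : Γ) x, ∀ᶠ x' in 𝓝 x, w (δ • x') = w (δ • x) := fun δ x =>
    (continuous_const_smul δ).continuousAt.eventually
      ((IsLocallyConstant.iff_eventually_eq w).1 hw (δ • x))
  have hfev : ∀ (δ : Γ) x, ∀ᶠ x' in 𝓝 x, f (δ • x') = f (δ • x) := fun δ x =>
    (continuous_const_smul δ).continuousAt.eventually
      ((IsLocallyConstant.iff_eventually_eq f).1 hf (δ • x))
  have hsel_ev : ∀ z, ∀ᶠ z' in 𝓝 z, hsel z' = hsel z := by
    intro z
    have h1 : ∀ᶠ z' in 𝓝 z, ∀ t t' : ι, ∀ c ∈ orbitComponent Ψ w z,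
        w ((θ t' * ((θ t)⁻¹ * c)) • z') = w ((θ t' * ((θ t)⁻¹ * c)) • z) ∧
        f ((θ t' * ((θ t)⁻¹ * c)) • z') = f ((θ t' * ((θ t)⁻¹ * c)) • z) :=
      Filter.eventually_all.2 fun t => Filter.eventually_all.2 fun t' =>
        (Filter.eventually_all_finite (hfin z)).2 fun c _ => (hwev _ z).and (hfev _ z)
    filter_upwards [h1, eventually_orbitComponent_eq hw (hfin z)] with z' h1 h2
    have : Q z' = Q z := by
      ext h
      simp only [Q, h2]
      refine forall_congr' fun t => forall₂_congr fun c hc => ?_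
      rw [condCount_congr B (Set.ext fun t' => ?_) fun t' _ => ?_]
      · simp only [Set.mem_ofPred_eq, (h1 t t' c hc).1]
      · simp only [(h1 t t' c hc).2]
    simp only [hsel, this]
  -- All points of a level-`j` component consult the choice made at their common root, each at its
  -- own position `(r x)⁻¹` relative to it.
  refine ⟨fun x => if w x = j then hsel (r x • x) (r x)⁻¹ else f x, ?_, fun x => ?_⟩
  · rw [IsLocallyConstant.iff_eventually_eq]
    intro x
    filter_upwards [(IsLocallyConstant.iff_eventually_eq w).1 hw x,
      (IsLocallyConstant.iff_eventually_eq f).1 hf x,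
      (IsLocallyConstant.iff_eventually_eq r).1 hrc x,
      (continuous_const_smul (r x)).continuousAt.eventually (hsel_ev (r x • x))] with x' h1 h2 h3 h4
    simp only [h1, h2, h3, h4]
  · by_cases hx : ∃ t, w (θ t • x) = j
    · obtain ⟨t, ht⟩ := hx
      set y := θ t • x with hy
      set z := r y • y with hz
      have hwz : w z = j := (eq_of_mem_orbitComponent (hr y)).trans ht
      have hc : (r y)⁻¹ ∈ orbitComponent Ψ w z := inv_mem_orbitComponent hΨ (hr y)
      have hxz : x = ((θ t)⁻¹ * (r y)⁻¹) • z := by simp [hz, hy, smul_smul]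
      have hxz' : ∀ t', (θ t' * ((θ t)⁻¹ * (r y)⁻¹)) • z = θ t' • x := fun t' => by
        rw [mul_smul, ← hxz]
      refine le_trans (le_of_eq (condCount_congr B ?_ fun t' ht' => ?_))
        (hsel_spec z hwz t _ hc)
      · ext t'
        simp only [Set.mem_ofPred_eq, hxz']
      · simp only [Set.mem_ofPred_eq] at ht'
        simp only [hxz']
        by_cases h : w (θ t' • x) = j
        · have hmem : θ t' * (θ t)⁻¹ ∈ orbitComponent Ψ w y := by
            refine orbitComponent_step one_mem_orbitComponent (by simpa using hθΨ t' t) ?_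
            rw [hy, smul_smul, inv_mul_cancel_right, h, ← ht]
          have h1 : θ t' • x = (θ t' * (θ t)⁻¹) • y := by simp [hy, smul_smul]
          have h2 : r (θ t' • x) = r y * (θ t' * (θ t)⁻¹)⁻¹ := by rw [h1, hrs y _ hmem]
          have h3 : θ t' * ((θ t)⁻¹ * (r y)⁻¹) ∈ orbitComponent Ψ w z := by
            rw [hz, mem_orbitComponent_smul_iff hΨ (hr y)]
            simpa [mul_assoc] using hmem
          rw [if_pos h, if_pos h3, h2]
          congr 1
          · rw [h1, smul_smul, inv_mul_cancel_right, hz]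
          · simp [mul_assoc]
        · have h3 : θ t' * ((θ t)⁻¹ * (r y)⁻¹) ∉ orbitComponent Ψ w z := by
            intro h3
            have := eq_of_mem_orbitComponent h3
            rw [hxz'] at this
            omega
          rw [if_neg h, if_neg h3]
    · push Not at hx
      have hb : b ≤ 4 * Fintype.card ι ^ 2 * b := by
        have : 0 < 4 * Fintype.card ι ^ 2 := by positivity
        exact Nat.le_mul_of_pos_left b this
      refine le_trans (le_of_eq (condCount_congr B ?_ fun t' ht' => ?_)) ((hfb x).trans hb)
      · ext t'
        have := hx t'
        simp only [Set.mem_ofPred_eq]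
        omega
      · simp [hx t']

/-- The continuous local lemma: if a free action admits a locally constant map `w` to `{0, …, s}`
all of whose level sets have finite components at the scale of the window `θ`, then a family `B`
of bad patterns of small density can be avoided in a locally constant way. -/
theorem exists_isLocallyConstant_forall_notMem {Γ X ι K : Type*} [Group Γ] [TopologicalSpace X]
    [MulAction Γ X] [ContinuousConstSMul Γ X] [Fintype ι] [Nonempty ι] [Fintype K] [Nonempty K]
    (hfree : IsFreeAction Γ X) (ρ : X → ℝ) (hρ : Continuous ρ) (hρ' : Function.Injective ρ)
    (θ : ι → Γ) (hθ : Function.Injective θ) {Ψ : Finset Γ} (hΨ : ∀ σ ∈ Ψ, σ⁻¹ ∈ Ψ)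
    (hθΨ : ∀ t t', θ t * (θ t')⁻¹ ∈ Ψ) {w : X → ℕ} (hw : IsLocallyConstant w)
    (hfin : ∀ x, (orbitComponent Ψ w x).Finite) (s : ℕ) (hws : ∀ x, w x ≤ s)
    (B : Finset (ι → K))
    (hB : (4 * Fintype.card ι ^ 2) ^ (s + 1) * #B < Fintype.card K ^ Fintype.card ι) :
    ∃ f : X → K, IsLocallyConstant f ∧ ∀ x, (fun t => f (θ t • x)) ∉ B := by
  classical
  have key : ∀ j : ℕ, ∃ f : X → K, IsLocallyConstant f ∧
      ∀ x, condCount B {t | w (θ t • x) < j} (fun t => f (θ t • x)) ≤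
        (4 * Fintype.card ι ^ 2) ^ j * #B := by
    intro j
    induction j with
    | zero =>
      obtain ⟨k⟩ := ‹Nonempty K›
      refine ⟨fun _ => k, IsLocallyConstant.const k, fun x => ?_⟩
      simp [condCount_empty]
    | succ j ih =>
      obtain ⟨f, hf, hfb⟩ := ih
      obtain ⟨f', hf', hfb'⟩ := exists_isLocallyConstant_condCount_succ hfree ρ hρ hρ' θ hθ hΨ hθΨ
        hw hfin B _ j f hf hfb
      refine ⟨f', hf', fun x => (hfb' x).trans (le_of_eq ?_)⟩
      rw [pow_succ']; ring
  obtain ⟨f, hf, hfb⟩ := key (s + 1)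
  refine ⟨f, hf, fun x hx => ?_⟩
  have h1 := hfb x
  -- After `s + 1` stages every value is fixed, so a bad pattern would have the full count, contrary
  -- to `hB`.
  have h2 : {t | w (θ t • x) < s + 1} = Set.univ := by
    ext t; simpa using Nat.lt_succ_of_le (hws _)
  rw [h2, condCount_univ hx, Fintype.card_fun] at h1
  omega

/-! ### Labellings with isolated marks of every kind -/

/-- A large finite set contains `m` elements with pairwise disjoint translates of `E`. -/
theorem exists_subset_card_eq_disjoint_translates {Γ : Type*} [Group Γ] (E : Finset Γ)
    (hE : (1 : Γ) ∈ E) (m : ℕ) (F : Finset Γ) (hF : m * #E ^ 2 ≤ #F) :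
    ∃ F' ⊆ F, #F' = m ∧
      ∀ σ ∈ F', ∀ σ' ∈ F', ∀ e ∈ E, ∀ e' ∈ E, e * σ = e' * σ' → σ = σ' := by
  classical
  induction m generalizing F with
  | zero => exact ⟨∅, by simp, by simp, by simp⟩
  | succ m ih =>
    have hpos : 0 < #E := card_pos.2 ⟨1, hE⟩
    have hFpos : 0 < #F := lt_of_lt_of_le (by positivity) hF
    obtain ⟨σ₀, hσ₀⟩ := card_pos.1 hFpos
    -- Greedy choice: `T` is the set of elements whose translate of `E` meets that of `σ₀`.
    set T := (E ×ˢ E).image (fun p => p.1⁻¹ * p.2 * σ₀) with hT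
    have hTc : #T ≤ #E ^ 2 := card_image_le.trans (by rw [card_product, sq])
    have h1 : m * #E ^ 2 ≤ #(F \ T) := by
      have := le_card_sdiff T F
      have h2 : (m + 1) * #E ^ 2 = m * #E ^ 2 + #E ^ 2 := by ring
      omega
    obtain ⟨F', hF', hc, hd⟩ := ih (F \ T) h1
    have hnot : ∀ σ ∈ F', ∀ e ∈ E, ∀ e' ∈ E, e * σ ≠ e' * σ₀ := by
      intro σ hσ e he e' he' h
      refine (mem_sdiff.1 (hF' hσ)).2 (mem_image.2 ⟨(e, e'), mem_product.2 ⟨he, he'⟩, ?_⟩)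
      simp [mul_assoc, ← h]
    have hσF : σ₀ ∉ F' := fun h => hnot σ₀ h 1 hE 1 hE rfl
    refine ⟨insert σ₀ F', ?_, by rw [card_insert_of_notMem hσF, hc], ?_⟩
    · exact insert_subset hσ₀ (hF'.trans sdiff_subset)
    · intro σ hσ σ' hσ' e he e' he' h
      rcases mem_insert.1 hσ with h1 | hσ <;> rcases mem_insert.1 hσ' with h2 | hσ'
      · rw [h1, h2]
      · exact absurd (h1 ▸ h.symm) (hnot σ' hσ' e' he' e he)
      · exact absurd (h2 ▸ h) (hnot σ hσ e he e' he')
      · exact hd σ hσ σ' hσ' e he e' he' h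

open Classical in
/-- The number of configurations in which one of `k` prescribed patterns occurs in no block. -/
theorem card_filter_exists_forall_ne_le {α β K : Type*} [Fintype α] [Fintype β] [Fintype K]
    {k : ℕ} (P : Fin k → β → K) :
    #{g : α × β → K | ∃ i, ∀ a, (fun b => g (a, b)) ≠ P i} ≤
      k * (Fintype.card K ^ Fintype.card β - 1) ^ Fintype.card α := by
  have h1 : ({g : α × β → K | ∃ i, ∀ a, (fun b => g (a, b)) ≠ P i} : Finset (α × β → K)) ⊆
      (Finset.univ : Finset (Fin k)).biUnion
        fun i => {g : α × β → K | ∀ a, (fun b => g (a, b)) ≠ P i} := by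
    intro g hg
    obtain ⟨i, hi⟩ := (mem_filter.1 hg).2
    exact mem_biUnion.2 ⟨i, mem_univ _, mem_filter.2 ⟨mem_univ _, hi⟩⟩
  refine (card_le_card h1).trans (card_biUnion_le.trans ?_)
  have h2 : ∀ i, #{g : α × β → K | ∀ a, (fun b => g (a, b)) ≠ P i} ≤
      (Fintype.card K ^ Fintype.card β - 1) ^ Fintype.card α := by
    intro i
    have h3 : #{g : α × β → K | ∀ a, (fun b => g (a, b)) ≠ P i} ≤
        #(Fintype.piFinset fun _ : α => (Finset.univ : Finset (β → K)).erase (P i)) := by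
      refine card_le_card_of_injOn (fun g a b => g (a, b)) ?_ ?_
      · intro g hg
        simpa using hg
      · intro g _ g' _ h
        ext ⟨a, b⟩
        exact congrFun (congrFun h a) b
    refine h3.trans (le_of_eq ?_)
    simp [Fintype.card_piFinset, card_erase_of_mem]
  refine (sum_le_sum fun i _ => h2 i).trans (by simp)

/-- Exponential decay beats polynomial growth. -/
theorem exists_pow_mul_lt_pow (k s ε c : ℕ) (hc : 1 ≤ c) :
    ∃ m : ℕ, 0 < m ∧ (4 * (m * ε) ^ 2) ^ (s + 1) * (k * (c - 1) ^ m) < c ^ m := by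
  have hc0 : (0 : ℝ) < c := by exact_mod_cast hc
  set r : ℝ := (c - 1) / c with hr
  have hr0 : 0 ≤ r := div_nonneg (by simpa using (by exact_mod_cast hc : (1 : ℝ) ≤ c)) hc0.le
  have hr1 : r < 1 := by rw [hr, div_lt_one hc0]; linarith
  have h1 := (tendsto_pow_const_mul_const_pow_of_abs_lt_one (2 * (s + 1))
    (by rwa [abs_of_nonneg hr0] : |r| < 1)).const_mul ((4 * (ε : ℝ) ^ 2) ^ (s + 1) * k)
  rw [mul_zero] at h1
  obtain ⟨m, hm, hm0⟩ := ((h1.eventually (gt_mem_nhds one_pos)).and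
    (Filter.eventually_gt_atTop 0)).exists
  refine ⟨m, hm0, ?_⟩
  have h2 : (((4 * (m * ε) ^ 2) ^ (s + 1) * (k * (c - 1) ^ m) : ℕ) : ℝ) < ((c ^ m : ℕ) : ℝ) := by
    push_cast [Nat.cast_sub hc]
    have h3 : ((c : ℝ) - 1) ^ m = r ^ m * c ^ m := by
      rw [← mul_pow, hr, div_mul_cancel₀ _ hc0.ne']
    rw [h3]
    have hcm : (0 : ℝ) < (c : ℝ) ^ m := pow_pos hc0 m
    calc (4 * ((m : ℝ) * ε) ^ 2) ^ (s + 1) * ((k : ℝ) * (r ^ m * (c : ℝ) ^ m))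
        = ((4 * (ε : ℝ) ^ 2) ^ (s + 1) * k * (m ^ (2 * (s + 1)) * r ^ m)) * (c : ℝ) ^ m := by
          rw [pow_mul, mul_pow (m : ℝ), ← mul_assoc 4, mul_comm (4 : ℝ), mul_assoc,
            mul_pow ((m : ℝ) ^ 2)]
          ring
      _ < 1 * (c : ℝ) ^ m := by gcongr
      _ = (c : ℝ) ^ m := one_mul _
  exact_mod_cast h2

/-- In a free action with separators at all scales, every sufficiently large finite set `F` admits
a locally constant labelling in which all labels occur `F`-syndetically at places with blank
`E`-neighbourhoods. -/
theorem exists_isLocallyConstant_label {Γ X : Type*} [Group Γ] [TopologicalSpace X]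
    [MulAction Γ X] [ContinuousConstSMul Γ X] (hfree : IsFreeAction Γ X) (ρ : X → ℝ)
    (hρ : Continuous ρ) (hρ' : Function.Injective ρ) (s : ℕ)
    (hsep : ∀ Ψ : Finset Γ, ∃ w : X → ℕ, IsLocallyConstant w ∧ (∀ x, w x ≤ s) ∧
      ∀ x, (orbitComponent Ψ w x).Finite) (k : ℕ) (E : Finset Γ) (hE : (1 : Γ) ∈ E) :
    ∃ n : ℕ, ∀ F : Finset Γ, n ≤ #F → ∃ f : X → Option (Fin k), IsLocallyConstant f ∧
      ∀ x i, ∃ σ ∈ F, f (σ • x) = some i ∧ ∀ e ∈ E, e ≠ 1 → f ((e * σ) • x) = none := by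
  classical
  set c := Fintype.card (Option (Fin k)) ^ Fintype.card E with hc
  -- `c` counts the patterns on one block, and a window of `m` blocks has size `m * #E`. The choice
  -- of `m` does not involve `F`.
  obtain ⟨m, hm0, hm⟩ := exists_pow_mul_lt_pow k s #E c (Nat.one_le_pow _ _ Fintype.card_pos)
  refine ⟨m * #E ^ 2, fun F hF => ?_⟩
  obtain ⟨F', hF', hcard, hdis⟩ := exists_subset_card_eq_disjoint_translates E hE m F hF
  let θ : F' × E → Γ := fun p => p.2 * p.1
  have hθ : Function.Injective θ := by
    rintro ⟨⟨σ, hσ⟩, ⟨e, he⟩⟩ ⟨⟨σ', hσ'⟩, ⟨e', he'⟩⟩ h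
    simp only [θ] at h
    obtain rfl := hdis σ hσ σ' hσ' e he e' he' h
    obtain rfl := mul_right_cancel h
    rfl
  let Ψ : Finset Γ := Finset.univ.image fun p : (F' × E) × (F' × E) => θ p.1 * (θ p.2)⁻¹
  have hθΨ : ∀ t t', θ t * (θ t')⁻¹ ∈ Ψ := fun t t' => mem_image.2 ⟨(t, t'), mem_univ _, rfl⟩
  have hΨ : ∀ σ ∈ Ψ, σ⁻¹ ∈ Ψ := by
    intro σ hσ
    obtain ⟨⟨t, t'⟩, -, rfl⟩ := mem_image.1 hσ
    simpa using hθΨ t' t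
  obtain ⟨w, hw, hws, hfin⟩ := hsep Ψ
  let P : Fin k → E → Option (Fin k) := fun i e => if (e : Γ) = 1 then some i else none
  have : Nonempty (F' × E) := by
    obtain ⟨σ, hσ⟩ := card_pos.1 (hcard ▸ hm0)
    exact ⟨(⟨σ, hσ⟩, ⟨1, hE⟩)⟩
  -- Bad: for some `i`, no block shows an isolated mark `i` at its centre `1`.
  set B : Finset (F' × E → Option (Fin k)) := {g | ∃ i, ∀ a, (fun b => g (a, b)) ≠ P i} with hB
  have hBc : #B ≤ k * (c - 1) ^ m := by
    have := card_filter_exists_forall_ne_le (α := F') P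
    rw [Fintype.card_coe F', hcard] at this
    convert this
  have hBlt : (4 * Fintype.card (F' × E) ^ 2) ^ (s + 1) * #B <
      Fintype.card (Option (Fin k)) ^ Fintype.card (F' × E) := by
    rw [Fintype.card_prod, Fintype.card_coe F', hcard, mul_comm m (Fintype.card E), pow_mul _ _ m,
      ← hc, mul_comm (Fintype.card E) m, Fintype.card_coe]
    exact lt_of_le_of_lt (Nat.mul_le_mul_left _ hBc) hm
  obtain ⟨f, hf, hfB⟩ := exists_isLocallyConstant_forall_notMem hfree ρ hρ hρ' θ hθ hΨ hθΨ hw hfin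
    s hws B hBlt
  refine ⟨f, hf, fun x i => ?_⟩
  have := hfB x
  simp only [hB, mem_filter, mem_univ, true_and, not_exists, not_forall, not_not] at this
  obtain ⟨σ, hσ⟩ := this i
  have hσ' : ∀ e ∈ E, f ((e * σ) • x) = if e = 1 then some i else none := fun e he =>
    congrFun hσ ⟨e, he⟩
  refine ⟨σ, hF' σ.2, by simpa using hσ' 1 hE, fun e he h1 => ?_⟩
  rw [hσ' e he, if_neg h1]

end LocalLemma

/-! ### Separators -/

/-- A set is graph-finite if each of its points lies in a finite set closed under adjacency. -/
theorem graphFinite_iff_exists_finite_closed {V : Type*} (G : SimpleGraph V) (U : Set V) :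
    GraphFinite G U ↔ ∀ v ∈ U, ∃ T : Set V, T.Finite ∧ v ∈ T ∧
      ∀ a ∈ T, a ∈ U → ∀ b ∈ U, G.Adj a b → b ∈ T := by
  constructor
  · intro h v hv
    refine ⟨Subtype.val '' ((G.induce U).connectedComponentMk ⟨v, hv⟩).supp, (h _).image _,
      ⟨⟨v, hv⟩, rfl, rfl⟩, ?_⟩
    rintro _ ⟨⟨a, ha⟩, haC, rfl⟩ - b hb hab
    refine ⟨⟨b, hb⟩, ?_, rfl⟩
    rw [SimpleGraph.ConnectedComponent.mem_supp_iff] at haC ⊢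
    rw [← haC, SimpleGraph.ConnectedComponent.eq]
    exact (SimpleGraph.Adj.reachable (G := G.induce U) (u := ⟨a, ha⟩) (v := ⟨b, hb⟩) hab).symm
  · intro h C
    induction C using SimpleGraph.ConnectedComponent.ind with
    | h v =>
    obtain ⟨v, hv⟩ := v
    obtain ⟨T, hT, hvT, hcl⟩ := h v hv
    refine Set.Finite.of_finite_image (f := Subtype.val) (hT.subset ?_)
      Subtype.val_injective.injOn
    rintro _ ⟨b, hb, rfl⟩
    rw [SimpleGraph.ConnectedComponent.mem_supp_iff, SimpleGraph.ConnectedComponent.eq] at hb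
    have hb' := hb.symm
    rw [SimpleGraph.reachable_iff_reflTransGen] at hb'
    induction hb' with
    | refl => exact hvT
    | @tail a b h1 hab ih =>
      refine hcl _ (ih ?_) a.2 _ b.2 hab
      exact ((SimpleGraph.reachable_iff_reflTransGen _ _).2 h1).symm

/-- The witness `T` need not be the component and may contain points of other colours, which makes
it easy to build. -/
theorem isSeparator_iff {Γ : Type*} [Group Γ] {s : ℕ} {Φ : Finset Γ}
    {x : BernoulliShift (s + 1) Γ} :
    IsSeparator s Φ x ↔ ∀ v, ∃ T : Set Γ, T.Finite ∧ v ∈ T ∧ ∀ a ∈ T, x a = x v → ∀ σ : Γ,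
      (σ ∈ Φ ∨ σ⁻¹ ∈ Φ) → x (σ * a) = x v → σ * a ∈ T := by
  simp only [IsSeparator, graphFinite_iff_exists_finite_closed]
  constructor
  · intro h v
    obtain ⟨T, hT, hv, hcl⟩ := h (x v) v rfl
    refine ⟨T, hT, hv, fun a ha hav σ hσ hσv => ?_⟩
    by_cases heq : a = σ * a
    · rwa [← heq]
    · refine hcl a ha hav _ hσv ⟨heq, ?_⟩
      rcases hσ with hσ | hσ
      · exact Or.inl ⟨σ, hσ, rfl⟩
      · exact Or.inr ⟨σ⁻¹, hσ, by simp⟩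
  · rintro h _ v rfl
    obtain ⟨T, hT, hv, hcl⟩ := h v
    refine ⟨T, hT, hv, fun a ha hav b hb hab => ?_⟩
    rcases hab.2 with ⟨σ, hσ, rfl⟩ | ⟨σ, hσ, rfl⟩
    · exact hcl a ha hav σ (Or.inl hσ) hb
    · have := hcl _ ha hav σ⁻¹ (Or.inr (by simpa using hσ))
      simp only [smul_eq_mul, inv_mul_cancel_left] at this
      exact this hb

theorem BernoulliShift.continuous_apply {k : ℕ} {Γ : Type*} (γ : Γ) :
    Continuous fun x : BernoulliShift k Γ => x γ :=
  _root_.continuous_apply (A := fun _ : Γ => Fin k) γ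

/-- For fixed `v`, whether a finite `T` is a witness depends on finitely many coordinates, so the
existence of a witness is an open condition; there are countably many `v`. -/
theorem isGδ_setOf_isSeparator {Γ : Type*} [Group Γ] [Countable Γ] (s : ℕ) (Φ : Finset Γ) :
    IsGδ {x : BernoulliShift (s + 1) Γ | IsSeparator s Φ x} := by
  have heq : {x : BernoulliShift (s + 1) Γ | IsSeparator s Φ x} =
      ⋂ v : Γ, ⋃ T : {T : Finset Γ // v ∈ T}, ⋂ a ∈ T.1, ⋂ σ ∈ Φ,
        {x | x a = x v → (x (σ * a) = x v → σ * a ∈ T.1) ∧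
          (x (σ⁻¹ * a) = x v → σ⁻¹ * a ∈ T.1)} := by
    ext x
    simp only [Set.mem_ofPred_eq, Set.mem_iInter, Set.mem_iUnion, isSeparator_iff]
    refine forall_congr' fun v => ?_
    constructor
    · rintro ⟨T, hT, hv, h⟩
      refine ⟨⟨hT.toFinset, by simpa using hv⟩, fun a ha σ hσ hav => ?_⟩
      simp only [Set.Finite.mem_toFinset] at ha ⊢
      exact ⟨h a ha hav σ (Or.inl hσ), h a ha hav σ⁻¹ (Or.inr (by simpa using hσ))⟩
    · rintro ⟨⟨T, hv⟩, h⟩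
      refine ⟨T, T.finite_toSet, hv, fun a ha hav σ hσ hσv => ?_⟩
      rcases hσ with hσ | hσ
      · exact (h a ha σ hσ hav).1 hσv
      · have := (h a ha σ⁻¹ hσ hav).2
        rw [inv_inv] at this
        exact this hσv
  rw [heq]
  refine IsGδ.iInter fun v => (isOpen_iUnion fun T => ?_).isGδ
  refine isOpen_biInter_finset fun a _ => isOpen_biInter_finset fun σ _ => ?_
  have hcl : ∀ (g g' : Γ) (p : Prop), IsOpen {x : BernoulliShift (s + 1) Γ | x g = x g' → p} := by
    intro g g' p
    have h1 : IsClopen {q : Fin (s + 1) × Fin (s + 1) | q.1 = q.2 → p} := isClopen_discrete _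
    exact h1.isOpen.preimage
      ((BernoulliShift.continuous_apply g).prodMk (BernoulliShift.continuous_apply g'))
  have h2 : {x : BernoulliShift (s + 1) Γ | x a = x v → (x (σ * a) = x v → σ * a ∈ T.1) ∧
      (x (σ⁻¹ * a) = x v → σ⁻¹ * a ∈ T.1)} =
      {x | x a = x v → False} ∪ ({x | x (σ * a) = x v → σ * a ∈ T.1} ∩
        {x | x (σ⁻¹ * a) = x v → σ⁻¹ * a ∈ T.1}) := by
    ext x
    simp only [Set.mem_ofPred_eq, Set.mem_union, Set.mem_inter_iff]
    tauto
  rw [h2]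
  exact (hcl _ _ _).union ((hcl _ _ _).inter (hcl _ _ _))

theorem orbitComponent_finite_of_isSeparator {Γ X : Type*} [Group Γ] [MulAction Γ X] {s : ℕ}
    {Ψ : Finset Γ} {w : X → ℕ} {x : X} {u : BernoulliShift (s + 1) Γ} (hu : IsSeparator s Ψ u)
    (hwu : ∀ γ, w (γ • x) = u γ) : (orbitComponent Ψ w x).Finite := by
  obtain ⟨T, hT, h1, hcl⟩ := isSeparator_iff.1 hu 1
  have hu1 : ∀ γ, w (γ • x) = w x → u γ = u 1 := by
    intro γ h
    rw [← one_smul Γ x, smul_smul, mul_one, hwu, hwu] at h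
    exact Fin.ext h
  refine hT.subset fun γ hγ => ?_
  induction hγ with
  | refl => exact h1
  | @tail γ δ hγ h ih =>
    have := hcl γ ih (hu1 γ (eq_of_mem_orbitComponent hγ)) _ (Or.inl h.1)
    rw [inv_mul_cancel_right] at this
    exact this (hu1 δ h.2)

/-- Changing a separator on sparse translates of a finite set `D` yields a separator at a smaller
scale. -/
theorem IsSeparator.of_eq_off_translates {Γ : Type*} [Group Γ] {s : ℕ} {Φ Φ' D Ψ E : Finset Γ}
    (hΦ : ∀ σ, σ ∈ Φ ∨ σ⁻¹ ∈ Φ → σ ∈ Φ') (hΦ' : ∀ σ ∈ Φ', σ⁻¹ ∈ Φ')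
    (hΨ : Φ' ⊆ Ψ)
    (hΨ' : ∀ σ ∈ Φ', ∀ d ∈ D, ∀ d' ∈ D, ∀ σ' ∈ Φ', σ * d * (σ' * d')⁻¹ ∈ Ψ)
    (hE : ∀ σ ∈ Φ', ∀ d ∈ D, ∀ d' ∈ D, d'⁻¹ * σ * d ∈ E)
    {u z : BernoulliShift (s + 1) Γ} (hu : IsSeparator s Ψ u) (A : Set Γ)
    (hA : ∀ γ ∈ A, ∀ e ∈ E, e * γ ∈ A → e * γ = γ)
    (hz : ∀ η, (∀ γ ∈ A, ∀ d ∈ D, η ≠ d * γ) → z η = u η) : IsSeparator s Φ z := by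
  rw [isSeparator_iff] at hu ⊢
  intro v₀
  choose T hT hvT hcl using hu
  -- Seeds: `v₀`, and the points one step away from a translate of `D` that contains `v₀`. `Q` is
  -- then a finite set closed under `Ψ`-steps in the `u`-class of colour `z v₀`.
  set P : Set Γ := insert v₀ (⋃ σ ∈ Φ', ⋃ d ∈ D, ⋃ d' ∈ D, {σ * d * d'⁻¹ * v₀}) with hP
  have hPfin : P.Finite := by
    refine Set.Finite.insert _ ?_
    exact Φ'.finite_toSet.biUnion fun σ _ => D.finite_toSet.biUnion fun d _ =>
      D.finite_toSet.biUnion fun d' _ => Set.finite_singleton _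
  set Q : Set Γ := {q | u q = z v₀ ∧ ∃ p ∈ P, u p = z v₀ ∧ q ∈ T p} with hQ
  have hQfin : Q.Finite := by
    refine (hPfin.biUnion fun p _ => hT p).subset ?_
    rintro q ⟨-, p, hp, -, hq⟩
    exact Set.mem_biUnion hp hq
  have hQcl : ∀ q ∈ Q, ∀ σ ∈ Ψ, u (σ * q) = z v₀ → σ * q ∈ Q := by
    rintro q ⟨hq, p, hp, hpc, hqT⟩ σ hσ hσq
    exact ⟨hσq, p, hp, hpc, hcl p q hqT (hq.trans hpc.symm) σ (Or.inl hσ) (hσq.trans hpc.symm)⟩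
  have hQP : ∀ p ∈ P, u p = z v₀ → p ∈ Q := fun p hp hpc => ⟨hpc, p, hp, hpc, hvT p⟩
  let Off : Γ → Prop := fun η => ∀ γ ∈ A, ∀ d ∈ D, η ≠ d * γ
  let Near : Γ → Prop := fun γ => (∃ d ∈ D, v₀ = d * γ) ∨
    ∃ q ∈ Q, ∃ σ ∈ Φ', ∃ d ∈ D, q = σ * d * γ
  -- Entering a translate from `Q` and leaving it elsewhere amounts to a single `Ψ`-step for `u`.
  have hNear : ∀ γ, Near γ → ∀ σ ∈ Φ', ∀ d ∈ D, u (σ * d * γ) = z v₀ → σ * d * γ ∈ Q := by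
    rintro γ (⟨d', hd', h⟩ | ⟨q, hq, σ', hσ', d', hd', rfl⟩) σ hσ d hd huc
    · refine hQP _ (Set.mem_insert_of_mem _ ?_) huc
      simp only [Set.mem_iUnion]
      exact ⟨σ, hσ, d, hd, d', hd', by simp [h, mul_assoc]⟩
    · have := hQcl _ hq _ (hΨ' σ hσ d hd d' hd' σ' hσ')
      rw [show σ * d * (σ' * d')⁻¹ * (σ' * d' * γ) = σ * d * γ by group] at this
      exact this huc
  refine ⟨{v | (Off v ∧ v ∈ Q) ∨ ∃ γ ∈ A, (∃ d ∈ D, v = d * γ) ∧ Near γ}, ?_, ?_, ?_⟩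
  · have hfin : (Q ∪ (⋃ d ∈ D, ⋃ d' ∈ D, {d * d'⁻¹ * v₀}) ∪
        ⋃ q ∈ Q, ⋃ σ ∈ Φ', ⋃ d ∈ D, ⋃ d' ∈ D, {d' * (σ * d)⁻¹ * q}).Finite := by
      refine (hQfin.union ?_).union ?_
      · exact D.finite_toSet.biUnion fun d _ => D.finite_toSet.biUnion fun d' _ =>
          Set.finite_singleton _
      · exact hQfin.biUnion fun q _ => Φ'.finite_toSet.biUnion fun σ _ =>
          D.finite_toSet.biUnion fun d _ => D.finite_toSet.biUnion fun d' _ =>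
            Set.finite_singleton _
    refine hfin.subset ?_
    rintro v (⟨-, hv⟩ | ⟨γ, -, ⟨d, hd, rfl⟩, ⟨d', hd', h⟩ | ⟨q, hq, σ, hσ, d', hd', h⟩⟩)
    · exact Or.inl (Or.inl hv)
    · refine Or.inl (Or.inr ?_)
      simp only [Set.mem_iUnion]
      exact ⟨d, hd, d', hd', by simp [h, mul_assoc]⟩
    · refine Or.inr ?_
      simp only [Set.mem_iUnion]
      exact ⟨q, hq, σ, hσ, d', hd', d, hd, by simp [h, mul_assoc]⟩
  · by_cases hoff : Off v₀
    · exact Or.inl ⟨hoff, hQP _ (Set.mem_insert _ _) (hz _ hoff).symm⟩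
    · simp only [Off] at hoff
      push Not at hoff
      obtain ⟨γ, hγ, d, hd, h⟩ := hoff
      exact Or.inr ⟨γ, hγ, ⟨d, hd, h⟩, Or.inl ⟨d, hd, h⟩⟩
  · intro v hv hvc σ hσ hσv
    replace hσ := hΦ σ hσ
    by_cases hoff : Off (σ * v)
    · refine Or.inl ⟨hoff, ?_⟩
      have huc : u (σ * v) = z v₀ := (hz _ hoff).symm.trans hσv
      rcases hv with ⟨-, hvQ⟩ | ⟨γ, hγ, ⟨d, hd, rfl⟩, hnear⟩
      · exact hQcl v hvQ σ (hΨ hσ) huc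
      · rw [← mul_assoc] at huc ⊢
        exact hNear γ hnear σ hσ d hd huc
    · simp only [Off] at hoff
      push Not at hoff
      obtain ⟨γ', hγ', d', hd', h⟩ := hoff
      refine Or.inr ⟨γ', hγ', ⟨d', hd', h⟩, ?_⟩
      rcases hv with ⟨-, hvQ⟩ | ⟨γ, hγ, ⟨d, hd, rfl⟩, hnear⟩
      · exact Or.inr ⟨v, hvQ, σ⁻¹, hΦ' σ hσ, d', hd', by simp [mul_assoc, ← h]⟩
      · have h2 : d'⁻¹ * σ * d * γ = γ' := by
          rw [mul_assoc, mul_assoc, h, inv_mul_cancel_left]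
        have h3 := hA γ hγ _ (hE σ hσ d hd d' hd') (h2 ▸ hγ')
        rw [h2] at h3
        rwa [h3]

/-- Separators with at least two colours exist. -/
theorem exists_isSeparator {Γ : Type*} [Group Γ] [Countable Γ] {s : ℕ} (hs : 1 ≤ s)
    (Φ : Finset Γ) : ∃ x : BernoulliShift (s + 1) Γ, IsSeparator s Φ x := by
  classical
  obtain ⟨g, hg⟩ := exists_surjective_nat Γ
  -- A finite exhaustion in which neighbours of `S n` lie in `S (n + 1)`. Levels of adjacent points
  -- differ by at most one, so colouring by parity keeps components within a single finite level.
  let step : ℕ → Finset Γ → Finset Γ := fun n S =>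
    insert (g (n + 1)) (S ∪ (S ×ˢ Φ).image (fun p => p.2 * p.1) ∪
      (S ×ˢ Φ).image (fun p => p.2⁻¹ * p.1))
  obtain ⟨S, hS0, hS⟩ : ∃ S : ℕ → Finset Γ, S 0 = {g 0} ∧ ∀ n, S (n + 1) = step n (S n) :=
    ⟨fun n => Nat.rec {g 0} step n, rfl, fun _ => rfl⟩
  have hex : ∀ v, ∃ n, v ∈ S n := by
    intro v
    obtain ⟨n, rfl⟩ := hg v
    refine ⟨n, ?_⟩
    cases n with
    | zero => simp [hS0]
    | succ n => rw [hS]; exact Finset.mem_insert_self _ _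
  have hex' : ∀ v, ∃ n, v ∈ S n ∧ ∀ m, v ∈ S m → n ≤ m := fun v =>
    ⟨Nat.find (hex v), Nat.find_spec (hex v), fun m hm => Nat.find_min' _ hm⟩
  choose level hlevel hmin using hex'
  have hle : ∀ v σ, (σ ∈ Φ ∨ σ⁻¹ ∈ Φ) → level (σ * v) ≤ level v + 1 := by
    intro v σ hσ
    refine hmin _ _ ?_
    have hv := hlevel v
    rw [hS]
    refine Finset.mem_insert_of_mem ?_
    rcases hσ with hσ | hσ
    · exact Finset.mem_union_left _ (Finset.mem_union_right _
        (Finset.mem_image.2 ⟨(v, σ), Finset.mem_product.2 ⟨hv, hσ⟩, rfl⟩))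
    · exact Finset.mem_union_right _
        (Finset.mem_image.2 ⟨(v, σ⁻¹), Finset.mem_product.2 ⟨hv, hσ⟩, by simp⟩)
  refine ⟨fun v => ⟨level v % 2, by omega⟩, isSeparator_iff.2 fun v => ?_⟩
  refine ⟨{a | level a = level v}, (S (level v)).finite_toSet.subset ?_, rfl, ?_⟩
  · intro a (ha : level a = level v)
    exact ha ▸ hlevel a
  · intro a ha hav σ hσ hσv
    simp only [Fin.mk.injEq, Set.mem_ofPred_eq] at ha hav hσv ⊢
    have h1 := hle a σ hσ
    have h2 := hle (σ * a) σ⁻¹ (by simpa [or_comm] using hσ)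
    rw [inv_mul_cancel_left] at h2
    omega

/-! ### Polishness, zero-dimensionality and the free part -/

/-- An intersection of open sets `O n` embeds diagonally as a closed subset of their product. -/
theorem IsGδ.polishSpace {α : Type*} [TopologicalSpace α] [PolishSpace α] {S : Set α}
    (hS : IsGδ S) : PolishSpace S := by
  obtain ⟨O, hO, rfl⟩ := isGδ_iff_eq_iInter_nat.1 hS
  have : ∀ n, PolishSpace (O n) := fun n => (hO n).polishSpace
  let f : (⋂ n, O n : Set α) → ∀ n, O n := fun x n => ⟨x.1, Set.mem_iInter.1 x.2 n⟩
  have hf : IsClosedEmbedding f := by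
    refine ⟨⟨⟨?_⟩, ?_⟩, ?_⟩
    · have hc : Continuous f := continuous_pi fun n => continuous_subtype_val.subtype_mk _
      have hc' : Continuous fun y : ∀ n, O n => (y 0).1 :=
        continuous_subtype_val.comp (continuous_apply 0)
      exact (Topology.IsInducing.of_comp hc hc'
        (show IsInducing ((fun y : ∀ n, O n => (y 0).1) ∘ f) from IsInducing.subtypeVal)).eq_induced
    · exact fun x y h => Subtype.ext (congrArg (fun z : ∀ n, O n => (z 0).1) h)
    · have : Set.range f = ⋂ n, {y : ∀ n, O n | (y n).1 = (y 0).1} := by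
        ext y
        simp only [Set.mem_range, Set.mem_iInter, Set.mem_ofPred_eq]
        constructor
        · rintro ⟨x, rfl⟩ n
          rfl
        · intro h
          exact ⟨⟨(y 0).1, Set.mem_iInter.2 fun n => h n ▸ (y n).2⟩,
            funext fun n => Subtype.ext (h n).symm⟩
      rw [this]
      exact isClosed_iInter fun n => isClosed_eq
        (continuous_subtype_val.comp (continuous_apply n))
        (continuous_subtype_val.comp (continuous_apply 0))
  exact hf.polishSpace

/-- The graph of `x`, coded as a subset of `ℕ`, is a point of the Cantor set. This supplies the `ρ`
that singles out roots. -/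
theorem exists_continuous_injective_real (J : Type*) [Countable J] (k : ℕ) :
    ∃ ρ : (J → Fin k) → ℝ, Continuous ρ ∧ Function.Injective ρ := by
  classical
  obtain ⟨e, he⟩ := exists_injective_nat (J × Fin k)
  let f : (J → Fin k) → ℕ → Bool := fun x n => decide (∃ j, e (j, x j) = n)
  have hf : Continuous f := by
    refine continuous_pi fun n => ?_
    by_cases h : ∃ p, e p = n
    · obtain ⟨⟨j, i⟩, rfl⟩ := h
      have : (fun x => f x (e (j, i))) = fun x : J → Fin k => decide (x j = i) := by
        ext x
        simp only [f, he.eq_iff, Prod.mk.injEq, decide_eq_decide]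
        exact ⟨by rintro ⟨_, rfl, h⟩; exact h, fun h => ⟨j, rfl, h⟩⟩
      rw [this]
      exact (continuous_of_discreteTopology (f := fun a : Fin k => decide (a = i))).comp
        (continuous_apply j)
    · have : (fun x => f x n) = fun _ => false := by
        ext x
        simp only [f, decide_eq_false_iff_not]
        rintro ⟨j, hj⟩
        exact h ⟨_, hj⟩
      rw [this]
      exact continuous_const
  have hfi : Function.Injective f := by
    intro x y h
    ext j
    have := congrFun h (e (j, x j))
    simp only [f, he.eq_iff, Prod.mk.injEq, decide_eq_decide] at this
    obtain ⟨j', rfl, h⟩ := this.1 ⟨j, rfl, rfl⟩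
    rw [h]
  refine ⟨fun x => (cantorSetHomeomorphNatToBool.symm (f x)).1, ?_, ?_⟩
  · exact continuous_subtype_val.comp (cantorSetHomeomorphNatToBool.symm.continuous.comp hf)
  · exact Subtype.val_injective.comp (cantorSetHomeomorphNatToBool.symm.injective.comp hfi)

theorem Topology.IsInducing.isZeroDimensional {X Y : Type*} [TopologicalSpace X]
    [TopologicalSpace Y] {f : X → Y} (hf : IsInducing f) (hY : IsZeroDimensional Y) :
    IsZeroDimensional X := by
  have h := TopologicalSpace.IsTopologicalBasis.isInducing hf hY
  refine TopologicalSpace.IsTopologicalBasis.of_isOpen_of_subset (fun _ h => h.isOpen) h ?_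
  rintro _ ⟨U, hU, rfl⟩
  exact IsClopen.preimage hU hf.continuous

instance BernoulliShift.instPolishSpace (k : ℕ) (Γ : Type*) [Countable Γ] :
    PolishSpace (BernoulliShift k Γ) :=
  have : PolishSpace (Fin k) := { }
  inferInstanceAs (PolishSpace (Γ → Fin k))

instance BernoulliShift.instContinuousConstSMul (k : ℕ) (Γ : Type*) [Group Γ] :
    ContinuousConstSMul Γ (BernoulliShift k Γ) :=
  ⟨fun γ => continuous_pi fun δ => BernoulliShift.continuous_apply (δ * γ)⟩

instance SubMulAction.instContinuousConstSMul {Γ X : Type*} [Group Γ] [TopologicalSpace X]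
    [MulAction Γ X] [ContinuousConstSMul Γ X] (S : SubMulAction Γ X) : ContinuousConstSMul Γ S :=
  ⟨fun γ => ((continuous_const_smul γ).comp continuous_subtype_val).subtype_mk _⟩

instance SepFinset.instPolishSpace {Γ : Type*} [Group Γ] [Countable Γ] (s : ℕ) (Φ : Finset Γ) :
    PolishSpace (SepFinset s Φ) :=
  (isGδ_setOf_isSeparator s Φ).polishSpace

theorem isGδ_freePart (Γ X : Type*) [Group Γ] [Countable Γ] [TopologicalSpace X] [T2Space X]
    [MulAction Γ X] [ContinuousConstSMul Γ X] : IsGδ (freePart Γ X : Set X) := by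
  have : (freePart Γ X : Set X) = ⋂ γ : {γ : Γ // γ ≠ 1}, {x | γ.1 • x ≠ x} := by
    ext x
    simp only [Set.mem_iInter, Set.mem_ofPred_eq, Subtype.forall]
    change MulAction.stabilizer Γ x = ⊥ ↔ _
    rw [Subgroup.eq_bot_iff_forall]
    simp only [MulAction.mem_stabilizer_iff]
    exact forall_congr' fun γ => not_imp_not.symm
  rw [this]
  exact IsGδ.iInter fun γ =>
    (isOpen_ne_fun (continuous_const_smul γ.1) continuous_id).isGδ

theorem isFreeAction_freePart (Γ X : Type*) [Group Γ] [MulAction Γ X] :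
    IsFreeAction Γ (freePart Γ X) := by
  intro x
  have hx : MulAction.stabilizer Γ x.1 = ⊥ := x.2
  rw [← hx]
  ext γ
  simp [MulAction.mem_stabilizer_iff, Subtype.ext_iff]

/-! ### Equivariant self-maps of the free part of `Sep(s)` -/

/-- Outside a finite set of indices, every scale still occurs infinitely often. -/
theorem EnumeratesInfinitelyOften.exists_reindexing {Γ : Type*} {Φ : ℕ → Finset Γ}
    (hΦ : EnumeratesInfinitelyOften Φ) (I : Finset ℕ) :
    ∃ m : ℕ → ℕ, (∀ n ∉ I, Φ (m n) = Φ n) ∧ ∀ l, ∃ n ∉ I, m n = l := by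
  have h : ∀ A : Finset Γ, ∃ t : ℕ → ℕ, (∀ n, Φ (t n) = A) ∧
      ∀ l, Φ l = A → ∃ n ∉ I, Φ n = A ∧ t n = l := by
    intro A
    have h1 : ({n | Φ n = A} \ (I : Set ℕ)).Infinite := (hΦ A).sdiff I.finite_toSet
    have : Infinite ↥({n | Φ n = A} \ (I : Set ℕ)) := h1.to_subtype
    have : Infinite ↥{n | Φ n = A} := (hΦ A).to_subtype
    obtain ⟨e⟩ := nonempty_equiv_of_countable (α := ↥({n | Φ n = A} \ (I : Set ℕ)))
      (β := ↥{n | Φ n = A})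
    classical
    obtain ⟨n₀, hn₀ : Φ n₀ = A⟩ := (hΦ A).nonempty
    -- The indices of scale `A` outside `I` are matched with all indices of scale `A`; `n₀` is a
    -- default of the same scale.
    refine ⟨fun n => if hn : n ∈ {n | Φ n = A} \ (I : Set ℕ) then e ⟨n, hn⟩ else n₀, ?_, ?_⟩
    · intro n
      by_cases hn : n ∈ {n | Φ n = A} \ (I : Set ℕ)
      · simp only [hn, dite_true]; exact (e ⟨n, hn⟩).2
      · simpa only [hn, dite_false] using hn₀
    · intro l hl
      have hn := (e.symm ⟨l, hl⟩).2
      refine ⟨e.symm ⟨l, hl⟩, hn.2, hn.1, ?_⟩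
      simp only [hn, dite_true, Subtype.coe_eta, Equiv.apply_symm_apply]
  choose t ht ht' using h
  refine ⟨fun n => t (Φ n) n, fun n _ => ht _ n, fun l => ?_⟩
  obtain ⟨n, hn, hA, hl⟩ := ht' (Φ l) l rfl
  exact ⟨n, hn, by simp only [hA, hl]⟩

section FreeAsymptoticSep

variable {Γ : Type*} [Group Γ] {Φ : ℕ → Finset Γ} {s : ℕ}

/-- The coordinates of a point of `Free(Sep(s))`. -/
def freeSepCoord (y : freePart Γ (AsymptoticSep Φ s)) (p : ℕ × Γ) : Fin (s + 1) :=
  (y.1 p.1).1 p.2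

theorem freeSepCoord_smul (γ : Γ) (y : freePart Γ (AsymptoticSep Φ s)) (n : ℕ) (δ : Γ) :
    freeSepCoord (γ • y) (n, δ) = freeSepCoord y (n, δ * γ) :=
  rfl

theorem injective_freeSepCoord :
    Function.Injective (freeSepCoord : freePart Γ (AsymptoticSep Φ s) → _) := by
  intro x y h
  refine Subtype.ext (funext fun n => Subtype.ext (funext fun δ => ?_))
  exact congrFun h (n, δ)

theorem isInducing_freeSepCoord :
    IsInducing (freeSepCoord : freePart Γ (AsymptoticSep Φ s) → _) := by
  have h1 : IsInducing fun (y : freePart Γ (AsymptoticSep Φ s)) (n : ℕ) => (y.1 n).1 :=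
    (IsInducing.piMap fun _ => IsInducing.subtypeVal).comp IsInducing.subtypeVal
  have hc : Continuous (freeSepCoord : freePart Γ (AsymptoticSep Φ s) → _) :=
    continuous_pi fun p => (BernoulliShift.continuous_apply p.2).comp
      ((continuous_apply p.1).comp h1.continuous)
  let c : (ℕ × Γ → Fin (s + 1)) → (ℕ → BernoulliShift (s + 1) Γ) := fun x n δ => x (n, δ)
  have hc' : Continuous c :=
    continuous_pi fun n => continuous_pi fun δ => continuous_apply (n, δ)
  exact IsInducing.of_comp hc hc' h1

theorem isLocallyConstant_freeSepCoord (p : ℕ × Γ) :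
    IsLocallyConstant fun y : freePart Γ (AsymptoticSep Φ s) => freeSepCoord y p :=
  (IsLocallyConstant.iff_continuous _).2
    ((continuous_apply p).comp isInducing_freeSepCoord.continuous)

theorem isZeroDimensional_freePart_asymptoticSep :
    IsZeroDimensional (freePart Γ (AsymptoticSep Φ s)) :=
  isInducing_freeSepCoord.isZeroDimensional isTopologicalBasis_isClopen

theorem isSeparator_coord (y : AsymptoticSep Φ s) {n : ℕ} {A : Finset Γ} (h : Φ n = A) :
    IsSeparator s A (y n).1 := by
  subst h
  exact (y n).2

/-- At a scale `∅` every map is a separator, so that coordinate can be the indicator of `1`, which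
already has trivial stabilizer. -/
theorem nonempty_freePart_asymptoticSep [Countable Γ] (hΦ : EnumeratesInfinitelyOften Φ)
    (hs : 1 ≤ s) : Nonempty (freePart Γ (AsymptoticSep Φ s)) := by
  classical
  choose x hx using fun n => exists_isSeparator hs (Φ n)
  obtain ⟨n₀, hn₀⟩ := (hΦ ∅).nonempty
  let x₀ : BernoulliShift (s + 1) Γ := fun γ => if γ = 1 then ⟨1, by omega⟩ else ⟨0, by omega⟩
  have hx₀ : IsSeparator s (Φ n₀) x₀ := by
    rw [hn₀, isSeparator_iff]
    exact fun v => ⟨{v}, Set.finite_singleton v, rfl, by simp⟩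
  have hy : ∀ n, IsSeparator s (Φ n) (if n = n₀ then x₀ else x n) := by
    intro n
    by_cases h : n = n₀
    · subst h; simpa using hx₀
    · simpa [h] using hx n
  let y : AsymptoticSep Φ s := fun n => ⟨if n = n₀ then x₀ else x n, hy n⟩
  refine ⟨⟨y, ?_⟩⟩
  change MulAction.stabilizer Γ y = ⊥
  rw [Subgroup.eq_bot_iff_forall]
  intro γ hγ
  have h1 : (γ • y) n₀ = y n₀ := congrFun (MulAction.mem_stabilizer_iff.1 hγ) n₀
  have h2 : (y n₀).1 (1 * γ) = (y n₀).1 1 := congrFun (congrArg Subtype.val h1) 1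
  by_contra hne
  simp [y, x₀, hne] at h2

/-- Equivariant continuous maps into `Free(Sep(s))` from a locally constant code for finitely many
coordinates and a reindexing of the others. -/
theorem exists_continuous_equivariant (I : Finset ℕ) (m : ℕ → ℕ) (hm : ∀ n ∉ I, Φ (m n) = Φ n)
    (hm' : ∀ l, ∃ n ∉ I, m n = l) (p : ℕ → freePart Γ (AsymptoticSep Φ s) → Fin (s + 1))
    (hp : ∀ n, IsLocallyConstant (p n))
    (hsep : ∀ n ∈ I, ∀ y, IsSeparator s (Φ n) (fun δ => p n (δ • y))) :
    ∃ π : freePart Γ (AsymptoticSep Φ s) → freePart Γ (AsymptoticSep Φ s), Continuous π ∧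
      (∀ (γ : Γ) y, π (γ • y) = γ • π y) ∧
      ∀ y, ∀ n ∈ I, ∀ δ, freeSepCoord (π y) (n, δ) = p n (δ • y) := by
  classical
  let z : freePart Γ (AsymptoticSep Φ s) → ℕ → BernoulliShift (s + 1) Γ := fun y n =>
    if n ∈ I then fun δ => p n (δ • y) else (y.1 (m n)).1
  have hz : ∀ y n, IsSeparator s (Φ n) (z y n) := by
    intro y n
    by_cases hn : n ∈ I
    · simp only [z, hn]
      exact hsep n hn y
    · simp only [z, hn]
      exact isSeparator_coord y.1 (hm n hn)
  let z' : freePart Γ (AsymptoticSep Φ s) → AsymptoticSep Φ s := fun y n => ⟨z y n, hz y n⟩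
  -- Every coordinate of `y` reappears outside `I`, so whatever fixes `z' y` fixes `y`.
  have hfree : ∀ y, z' y ∈ freePart Γ (AsymptoticSep Φ s) := by
    intro y
    change MulAction.stabilizer Γ (z' y) = ⊥
    rw [Subgroup.eq_bot_iff_forall]
    intro γ hγ
    have hy : MulAction.stabilizer Γ y.1 = ⊥ := y.2
    rw [Subgroup.eq_bot_iff_forall] at hy
    refine hy γ (MulAction.mem_stabilizer_iff.2 (funext fun l => ?_))
    obtain ⟨n, hn, rfl⟩ := hm' l
    have h1 : (γ • z' y) n = z' y n := congrFun (MulAction.mem_stabilizer_iff.1 hγ) n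
    have h2 : γ • z y n = z y n := congrArg Subtype.val h1
    simp only [z, hn] at h2
    exact Subtype.ext h2
  have hcoord : ∀ y n δ, freeSepCoord (⟨z' y, hfree y⟩ : freePart Γ (AsymptoticSep Φ s)) (n, δ) =
      z y n δ := fun _ _ _ => rfl
  have hzI : ∀ y, ∀ n ∈ I, ∀ δ, z y n δ = p n (δ • y) := fun y n hn δ => by simp [z, hn]
  have hzI' : ∀ y, ∀ n ∉ I, ∀ δ, z y n δ = freeSepCoord y (m n, δ) := fun y n hn δ => by
    simp [z, hn, freeSepCoord]
  refine ⟨fun y => ⟨z' y, hfree y⟩, ?_, fun γ y => ?_, fun y n hn δ => ?_⟩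
  · rw [isInducing_freeSepCoord.continuous_iff]
    refine continuous_pi fun q => ?_
    obtain ⟨n, δ⟩ := q
    by_cases hn : n ∈ I
    · simp only [Function.comp_def, hcoord, hzI _ n hn]
      exact (hp n).continuous.comp (continuous_const_smul δ)
    · simp only [Function.comp_def, hcoord, hzI' _ n hn]
      exact (isLocallyConstant_freeSepCoord _).continuous
  · refine injective_freeSepCoord (funext fun q => ?_)
    obtain ⟨n, δ⟩ := q
    rw [freeSepCoord_smul, hcoord, hcoord]
    by_cases hn : n ∈ I
    · rw [hzI _ n hn, hzI _ n hn, smul_smul]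
    · rw [hzI' _ n hn, hzI' _ n hn, freeSepCoord_smul]
  · rw [hcoord, hzI y n hn]

theorem isAmplySyndetic_freePart_asymptoticSep [Countable Γ] (hΦ : EnumeratesInfinitelyOften Φ) :
    IsAmplySyndetic Γ (freePart Γ (AsymptoticSep Φ s)) := by
  classical
  refine ⟨(isGδ_freePart Γ (AsymptoticSep Φ s)).polishSpace, inferInstance, ?_⟩
  intro k U hU hUne
  choose x hx using hUne
  have hJ : ∀ i, ∃ J : Finset (ℕ × Γ), ∀ y : freePart Γ (AsymptoticSep Φ s),
      (∀ q ∈ J, freeSepCoord y q = freeSepCoord (x i) q) → y ∈ U i := by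
    intro i
    obtain ⟨O, hO, hOU⟩ := isInducing_freeSepCoord.isOpen_iff.1 (hU i)
    obtain ⟨J, u, hu, hJ⟩ := isOpen_pi_iff.1 hO (freeSepCoord (x i))
      (by rw [← Set.mem_preimage, hOU]; exact hx i)
    refine ⟨J, fun y hy => ?_⟩
    rw [← hOU]
    refine hJ fun q hq => ?_
    rw [hy q hq]
    exact (hu q hq).2
  choose J hJ using hJ
  set I : Finset ℕ := Finset.univ.biUnion fun i => (J i).image Prod.fst with hI
  set D : Finset Γ := Finset.univ.biUnion fun i => (J i).image Prod.snd with hD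
  set Θ : Finset Γ := I.biUnion Φ with hΘ
  set Φ' : Finset Γ := insert 1 (Θ ∪ Θ.image fun σ => σ⁻¹) with hΦ'
  have hΦ'inv : ∀ σ ∈ Φ', σ⁻¹ ∈ Φ' := by
    intro σ hσ
    simp only [hΦ', Finset.mem_insert, Finset.mem_union, Finset.mem_image] at hσ ⊢
    rcases hσ with rfl | hσ | ⟨τ, hτ, rfl⟩
    · simp
    · exact Or.inr (Or.inr ⟨σ, hσ, rfl⟩)
    · exact Or.inr (Or.inl (by simpa using hτ))
  have hΦΦ' : ∀ n ∈ I, ∀ σ, σ ∈ Φ n ∨ σ⁻¹ ∈ Φ n → σ ∈ Φ' := by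
    intro n hn σ hσ
    have hsub : ∀ τ ∈ Φ n, τ ∈ Φ' := fun τ hτ => Finset.mem_insert_of_mem
      (Finset.mem_union_left _ (Finset.mem_biUnion.2 ⟨n, hn, hτ⟩))
    rcases hσ with hσ | hσ
    · exact hsub σ hσ
    · simpa using hΦ'inv _ (hsub _ hσ)
  -- Isolation at scale `E` keeps the `D`-translates of distinct marks disjoint (as `1 ∈ Φ'`) and
  -- free of `Φ'`-edges between them.
  set E : Finset Γ := insert 1 ((Φ' ×ˢ D ×ˢ D).image fun q => q.2.2⁻¹ * q.1 * q.2.1) with hE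
  have hE1 : (1 : Γ) ∈ E := Finset.mem_insert_self _ _
  have hEm : ∀ σ ∈ Φ', ∀ d ∈ D, ∀ d' ∈ D, d'⁻¹ * σ * d ∈ E := fun σ hσ d hd d' hd' =>
    Finset.mem_insert_of_mem (Finset.mem_image.2 ⟨(σ, d, d'), by simp [hσ, hd, hd'], rfl⟩)
  set Ψ : Finset Γ := Φ' ∪ (Φ' ×ˢ D ×ˢ D ×ˢ Φ').image
    fun q => q.1 * q.2.1 * (q.2.2.2 * q.2.2.1)⁻¹ with hΨ
  have hΨm : ∀ σ ∈ Φ', ∀ d ∈ D, ∀ d' ∈ D, ∀ σ' ∈ Φ', σ * d * (σ' * d')⁻¹ ∈ Ψ :=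
    fun σ hσ d hd d' hd' σ' hσ' => Finset.mem_union_right _
      (Finset.mem_image.2 ⟨(σ, d, d', σ'), by simp [hσ, hd, hd', hσ'], rfl⟩)
  obtain ⟨l, hl⟩ := (hΦ Ψ).nonempty
  obtain ⟨m, hm, hm'⟩ := hΦ.exists_reindexing I
  obtain ⟨ρ, hρ, hρ'⟩ := exists_continuous_injective_real (ℕ × Γ) (s + 1)
  obtain ⟨N, hN⟩ := exists_isLocallyConstant_label
    (isFreeAction_freePart Γ (AsymptoticSep Φ s)) (ρ ∘ freeSepCoord)
    (hρ.comp isInducing_freeSepCoord.continuous) (hρ'.comp injective_freeSepCoord) s (by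
      intro Ψ'
      obtain ⟨j, hj⟩ := (hΦ Ψ').nonempty
      -- The separator for `Ψ'` is read off from the point: along its orbit, this function runs
      -- through coordinate `j`.
      refine ⟨fun y => (freeSepCoord y (j, 1) : ℕ),
        (isLocallyConstant_freeSepCoord _).comp _, fun y => Nat.le_of_lt_succ (Fin.is_lt _), fun y => ?_⟩
      refine orbitComponent_finite_of_isSeparator (isSeparator_coord y.1 hj) fun γ => ?_
      rw [freeSepCoord_smul, one_mul]
      rfl) k E hE1
  refine ⟨N, fun F hF => ?_⟩
  obtain ⟨f, hf, hfF⟩ := hN F hF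
  let A : Fin k → Set (freePart Γ (AsymptoticSep Φ s)) := fun i =>
    {y | f y = some i ∧ ∀ e ∈ E, e ≠ 1 → f (e • y) = none}
  have hAsep : ∀ i i' y, y ∈ A i → ∀ e ∈ E, e • y ∈ A i' → e = 1 ∧ i = i' := by
    intro i i' y hy e he hey
    by_cases h1 : e = 1
    · subst h1
      have h2 := hey.1
      rw [one_smul, hy.1] at h2
      exact ⟨rfl, Option.some_injective _ h2⟩
    · have h2 := hey.1
      rw [hy.2 e he h1] at h2
      simp at h2
  have hfev : ∀ (δ : Γ) y, ∀ᶠ y' in 𝓝 y, f (δ • y') = f (δ • y) := fun δ y =>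
    (continuous_const_smul δ).continuousAt.eventually
      ((IsLocallyConstant.iff_eventually_eq f).1 hf (δ • y))
  -- `R y` records the mark near `y`, by its kind and the displacement `d` from it; by `hRuniq`
  -- there is at most one.
  let R : freePart Γ (AsymptoticSep Φ s) → Set (Fin k × Γ) := fun y =>
    {q | q.2 ∈ D ∧ q.2⁻¹ • y ∈ A q.1}
  have hR : IsLocallyConstant R := by
    rw [IsLocallyConstant.iff_eventually_eq]
    intro y
    have h1 : ∀ᶠ y' in 𝓝 y, ∀ d ∈ D, f (d⁻¹ • y') = f (d⁻¹ • y) ∧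
        ∀ e ∈ E, f ((e * d⁻¹) • y') = f ((e * d⁻¹) • y) :=
      (Filter.eventually_all_finset D).2 fun d _ => (hfev _ y).and
        ((Filter.eventually_all_finset E).2 fun e _ => hfev _ y)
    filter_upwards [h1] with y' h1
    ext ⟨i, d⟩
    refine and_congr_right fun hd => and_congr (by rw [(h1 d hd).1]) ?_
    refine forall₂_congr fun e he => ?_
    rw [smul_smul, smul_smul, (h1 d hd).2 e he]
  have hRuniq : ∀ y q q', q ∈ R y → q' ∈ R y → q = q' := by
    rintro y ⟨i, d⟩ ⟨i', d'⟩ ⟨hd, hA⟩ ⟨hd', hA'⟩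
    have he : d'⁻¹ * d ∈ E := by
      simpa using hEm 1 (Finset.mem_insert_self _ _) d hd d' hd'
    obtain ⟨h1, h2⟩ := hAsep i i' _ hA _ he (by simpa [smul_smul] using hA')
    rw [h2, inv_mul_eq_one.1 h1]
  -- Near a mark of kind `i`, copy the pattern of `x i`; elsewhere, use the coordinate `l`, a
  -- separator at the coarse scale `Ψ`.
  let code : ℕ → Set (Fin k × Γ) × Fin (s + 1) → Fin (s + 1) := fun n r =>
    if h : r.1.Nonempty then freeSepCoord (x h.some.1) (n, h.some.2) else r.2
  obtain ⟨π, hπ, hπe, hπc⟩ := exists_continuous_equivariant I m hm hm'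
    (fun n y => code n (R y, freeSepCoord y (l, 1)))
    (fun n => (hR.prodMk (isLocallyConstant_freeSepCoord (l, 1))).comp (code n)) (by
      intro n hn y
      refine (isSeparator_coord y.1 hl).of_eq_off_translates (hΦΦ' n hn) hΦ'inv Finset.subset_union_left hΨm hEm
        {γ | ∃ i, γ • y ∈ A i} ?_ ?_
      · rintro γ ⟨i, hi⟩ e he ⟨i', hi'⟩
        rw [(hAsep i i' _ hi e he (by rwa [smul_smul])).1, one_mul]
      · intro η hη
        have hemp : ¬ (R (η • y)).Nonempty := by
          rintro ⟨⟨i, d⟩, hd, hA⟩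
          exact hη (d⁻¹ * η) ⟨i, by rwa [mul_smul]⟩ d hd (by simp)
        simp only [code, hemp, dite_false]
        rw [freeSepCoord_smul, one_mul]
        rfl)
  refine ⟨π, hπ, hπe, fun i y => ?_⟩
  obtain ⟨σ, hσF, hσ, hσE⟩ := hfF y i
  refine ⟨σ, hσF, hJ i _ fun q hq => ?_⟩
  obtain ⟨n, d⟩ := q
  have hnI : n ∈ I := Finset.mem_biUnion.2 ⟨i, Finset.mem_univ _, Finset.mem_image.2 ⟨_, hq, rfl⟩⟩
  have hdD : d ∈ D := Finset.mem_biUnion.2 ⟨i, Finset.mem_univ _, Finset.mem_image.2 ⟨_, hq, rfl⟩⟩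
  have hmem : (i, d) ∈ R (d • σ • y) := by
    refine ⟨hdD, ?_⟩
    simp only [inv_smul_smul]
    exact ⟨hσ, fun e he h1 => by rw [smul_smul]; exact hσE e he h1⟩
  have hne : (R (d • σ • y)).Nonempty := ⟨_, hmem⟩
  rw [hπc _ n hnI]
  simp only [code, hne, dite_true]
  rw [hRuniq _ _ _ hne.some_mem hmem]

end FreeAsymptoticSep

theorem exists_enumeratesInfinitelyOften (Γ : Type*) [Countable Γ] :
    ∃ Φ : ℕ → Finset Γ, EnumeratesInfinitelyOften Φ := by
  obtain ⟨g, hg⟩ := exists_surjective_nat (Finset Γ)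
  refine ⟨fun n => g n.unpair.1, fun A => ?_⟩
  obtain ⟨a, rfl⟩ := hg A
  refine Set.infinite_of_injective_forall_mem (f := fun m : ℕ => Nat.pair a m) ?_ ?_
  · intro m m' h
    exact (Nat.pair_eq_pair.1 h).2
  · intro m
    simp

theorem mainTheorem8 {Γ : Type u} [Group Γ] [Countable Γ] [Infinite Γ] :
    (∀ Φ : ℕ → Finset Γ, EnumeratesInfinitelyOften Φ → ∀ s : ℕ, 1 ≤ s →
      IsAmplySyndetic Γ (freePart Γ (AsymptoticSep Φ s)) ∧
      Nonempty (freePart Γ (AsymptoticSep Φ s)) ∧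
      IsFreeAction Γ (freePart Γ (AsymptoticSep Φ s)) ∧
      IsZeroDimensional (freePart Γ (AsymptoticSep Φ s))) ∧
    (∃ (X : Type u) (_ : TopologicalSpace X) (_ : MulAction Γ X),
      Nonempty X ∧ IsFreeAction Γ X ∧ IsZeroDimensional X ∧ IsAmplySyndetic Γ X) := by
  have h : ∀ Φ : ℕ → Finset Γ, EnumeratesInfinitelyOften Φ → ∀ s : ℕ, 1 ≤ s →
      IsAmplySyndetic Γ (freePart Γ (AsymptoticSep Φ s)) ∧
      Nonempty (freePart Γ (AsymptoticSep Φ s)) ∧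
      IsFreeAction Γ (freePart Γ (AsymptoticSep Φ s)) ∧
      IsZeroDimensional (freePart Γ (AsymptoticSep Φ s)) := fun Φ hΦ s hs =>
    ⟨isAmplySyndetic_freePart_asymptoticSep hΦ, nonempty_freePart_asymptoticSep hΦ hs,
      isFreeAction_freePart _ _, isZeroDimensional_freePart_asymptoticSep⟩
  refine ⟨h, ?_⟩
  obtain ⟨Φ, hΦ⟩ := exists_enumeratesInfinitelyOften Γ
  obtain ⟨h1, h2, h3, h4⟩ := h Φ hΦ 1 le_rfl
  exact ⟨freePart Γ (AsymptoticSep Φ 1), inferInstance, inferInstance, h2, h3, h4, h1⟩
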